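/- Let $d\ge 3$, let $\sigma$ be the surface measure of the unit sphere $\mathbb{S}^{d-1}\subset\mathbb{R}^d$, $|\mathbb{S}^{d-1}|=\sigma(\mathbb{S}^{d-1})$, and let $\Delta$ be the Laplace--Beltrami operator of $\mathbb{S}^{d-1}$, with unitary group $\mathrm{e}^{\mathrm{i}t\Delta}$ on $L^2(\mathbb{S}^{d-1},\sigma)$. For $k\ge 0$ let $N_{k,d}=\frac{(2k+d-2)(k+d-3)!}{k!\,(d-2)!}$ and let $P_{k,d}$ be defined by $\sum_{k\ge 0} r^kN_{k,d}P_{k,d}(t)=\frac{1-r^2}{(1+r^2-2rt)^{d/2}}$ ($|r|<1$, $|t|\le 1$). For $\xi,\eta\in\mathbb{S}^{d-1}$ and $n\ge0$ put $$Z_\xi^{(k)}(\eta)=\frac{N_{k,d}}{|\mathbb{S}^{d-1}|}P_{k,d}(\xi\cdot\eta),\qquad \mu_{n,k,d}=\frac{n!\,(n+d-2)!}{(n-k)!\,(n+k+d-2)!}\quad(0\le k\le n),$$ $$R_\xi^{(n)}=\sum_{k=0}^n\mu_{n,k,d}Z_\xi^{(k)},\qquad M_{n,d}=\sum_{k=0}^n\mu_{n,k,d}^2\frac{N_{k,d}}{|\mathbb{S}^{d-1}|},\qquad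 S_\xi^{(n)}=\frac{1}{\sqrt{M_{n,d}}}R_\xi^{(n)}.$$ Fix $\xi\in\mathbb{S}^{d-1}$. Then the following hold. 1. The $S_\xi^{(n)}$ are normalized approximate Dirac masses: $\|S_\xi^{(n)}\|_{L^2}=1$ for all $n$, and for every continuous $f:\mathbb{S}^{d-1}\to\mathbb{C}$, $\int R_\zeta^{(n)}f\,\mathrm{d}\sigma\to f(\zeta)$ as $n\to\infty$, uniformly in $\zeta\in\mathbb{S}^{d-1}$. 2. For every $n$ the function $(t,\eta)\mapsto(\mathrm{e}^{\mathrm{i}t\Delta}S_\xi^{(n)})(\eta)$ has a continuous version on $\mathbb{R}\times\mathbb{S}^{d-1}$; with this version, the limit $$p_\xi^{(n)}(\eta)=\lim_{T\to\infty}\frac1T\int_0^T|\mathrm{e}^{\mathrm{i}t\Delta}S_\xi^{(n)}(\eta)|^2\,\mathrm{d}t$$ exists for every $\eta$, is continuous in $\eta$, and $\int p_\xi^{(n)}\,\mathrm{d}\sigma=1$. The densities $p_\xi^{(n)}$ do not equidistribute as $n\to\infty$: it is not true that $\int a\,p_\xi^{(n)}\,\mathrm{d}\sigma\to\frac{1}{|\mathbb{S}^{d-1}|}\int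 a\,\mathrm{d}\sigma$ for every continuous $a:\mathbb{S}^{d-1}\to\mathbb{R}$. Moreover $p_\xi^{(n)}(\xi)\to\infty$ and $p_\xi^{(n)}(-\xi)\to\infty$ as $n\to\infty$, while for every $\eta\ne\pm\xi$ the sequence $(p_\xi^{(n)}(\eta))_n$ is bounded. 3. Let $d=3$ and $a(\eta)=(\xi\cdot\eta)^2$. For every $n$ the limit $$A_n=\lim_{T\to\infty}\frac1T\int_0^T\langle\mathrm{e}^{\mathrm{i}t\Delta}S_\xi^{(n)},a\,\mathrm{e}^{\mathrm{i}t\Delta}S_\xi^{(n)}\rangle\,\mathrm{d}t$$ exists, and $\liminf_{n\to\infty}A_n\ge\frac12$, whereas $\frac{1}{|\mathbb{S}^2|}\int a\,\mathrm{d}\sigma=\frac13$. In particular $A_n$ does not converge to the uniform average of $a$. -/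

import Mathlib

open MeasureTheory Filter Topology
open scoped Laplacian ContDiff

noncomputable section

namespace SphereFlow

/-- The unit sphere of `ℝ^d`. -/
abbrev Sph (d : ℕ) : Type := Metric.sphere (0 : EuclideanSpace ℝ (Fin d)) 1

/-- The (unnormalized) surface measure of the unit sphere of `ℝ^d`. -/
abbrev surf (d : ℕ) : Measure (Sph d) :=
  (volume : Measure (EuclideanSpace ℝ (Fin d))).toSphere

/-- The Euclidean inner product of two points of the sphere. -/
def dot {d : ℕ} (ξ η : Sph d) : ℝ :=
  inner ℝ (ξ : EuclideanSpace ℝ (Fin d)) (η : EuclideanSpace ℝ (Fin d))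

/-! ### The Laplace–Beltrami operator and its unitary group -/

/-- The extension of a function on the sphere to `ℝ^d` that is constant on open rays from the
origin, `x ↦ f (x / ‖x‖)` (with the irrelevant value `0` at the origin). -/
def radialExt {d : ℕ} (f : Sph d → ℂ) (x : EuclideanSpace ℝ (Fin d)) : ℂ :=
  open Classical in
  if h : x = 0 then 0
  else f ⟨‖x‖⁻¹ • x, by
    rw [mem_sphere_zero_iff_norm, norm_smul, norm_inv, norm_norm,
      inv_mul_cancel₀ (norm_ne_zero_iff.mpr h)]⟩

/-- Smoothness of a function on the sphere. -/
def SmoothOnSphere {d : ℕ} (f : Sph d → ℂ) : Prop :=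
  ContDiffOn ℝ ∞ (radialExt f) {0}ᶜ

/-- The Laplace–Beltrami operator of the round sphere (on smooth functions): the Euclidean
Laplacian of the radially constant extension, evaluated on the sphere. -/
def sphereLaplacian {d : ℕ} (f : Sph d → ℂ) (η : Sph d) : ℂ :=
  (Δ (radialExt f)) (η : EuclideanSpace ℝ (Fin d))

/-- The closed subspace of `L²` of the eigenfunctions of `-Δ` with eigenvalue `lam`. -/
def eigenspace (d : ℕ) (lam : ℝ) : Submodule ℂ (Lp ℂ 2 (surf d)) :=
  (Submodule.span ℂ {F : Lp ℂ 2 (surf d) | ∃ f : Sph d → ℂ, SmoothOnSphere f ∧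
    (∀ η, sphereLaplacian f η = -(lam : ℂ) * f η) ∧ F =ᵐ[surf d] f}).topologicalClosure

instance (d : ℕ) (lam : ℝ) : CompleteSpace (eigenspace d lam) :=
  (Submodule.isClosed_topologicalClosure _).completeSpace_coe

/-- The Schrödinger group `exp (i t Δ)` on `L²` of the sphere, by the spectral decomposition of
`Δ`: the sum over all `lam` of `exp (-i t lam)` times the orthogonal projection on the eigenspace
of `-Δ` for `lam` (these spaces are mutually orthogonal, so that the sum converges in `L²`). -/
def schrodinger (d : ℕ) (t : ℝ) (ψ : Lp ℂ 2 (surf d)) : Lp ℂ 2 (surf d) :=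
  ∑' lam : ℝ, Complex.exp (-(Complex.I * t * lam)) • (eigenspace d lam).starProjection ψ

/-- The expectation `⟨ψ, a ψ⟩ = ∫ a |ψ|²` of a real observable `a`. -/
def expectation {d : ℕ} (a : Sph d → ℝ) (ψ : Lp ℂ 2 (surf d)) : ℝ :=
  ∫ η, a η * ‖ψ η‖ ^ 2 ∂(surf d)

/-! ### Zonal harmonics and the approximate Dirac masses -/

/-- The dimension `N_{k,d}` of the space of spherical harmonics of degree `k`, for `d ≥ 3`. -/
def harmDim (d k : ℕ) : ℝ :=
  (2 * k + d - 2 : ℝ) * ((k + d - 3).factorial : ℝ) /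
    ((k.factorial : ℝ) * ((d - 2).factorial : ℝ))

/-- The Poisson kernel `(1 - r²) / (1 + r² - 2 r t)^{d/2}`. -/
def spherePoisson (d : ℕ) (t r : ℝ) : ℝ :=
  (1 - r ^ 2) / (1 + r ^ 2 - 2 * r * t) ^ ((d : ℝ) / 2)

/-- The Legendre polynomial `P_{k,d}`, defined by the Poisson identity
`∑ r^k N_{k,d} P_{k,d}(t) = (1 - r²) / (1 + r² - 2 r t)^{d/2}`, that is, `N_{k,d} P_{k,d}(t)` is the
Taylor coefficient of order `k` at `r = 0` of the right-hand side. -/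
def legendre (d k : ℕ) (t : ℝ) : ℝ :=
  iteratedDeriv k (spherePoisson d t) 0 / (k.factorial : ℝ) / harmDim d k

/-- The zonal harmonic `Z_ξ^{(k)}(η) = N_{k,d} / |S^{d-1}| * P_{k,d}(ξ · η)`. -/
def zonal (d k : ℕ) (ξ η : Sph d) : ℝ :=
  harmDim d k / (surf d).real Set.univ * legendre d k (dot ξ η)

/-- The weights `μ_{n,k,d}` (for `k ≤ n`). -/
def weight (d n k : ℕ) : ℝ :=
  ((n.factorial : ℝ) * ((n + d - 2).factorial : ℝ)) /
    (((n - k).factorial : ℝ) * ((n + k + d - 2).factorial : ℝ))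

/-- The unnormalized approximate Dirac mass `R_ξ^{(n)}`. -/
def diracKernel (d n : ℕ) (ξ η : Sph d) : ℝ :=
  ∑ k ∈ Finset.range (n + 1), weight d n k * zonal d k ξ η

/-- The constant `M_{n,d}`. -/
def normConst (d n : ℕ) : ℝ :=
  ∑ k ∈ Finset.range (n + 1), weight d n k ^ 2 * (harmDim d k / (surf d).real Set.univ)

/-- The normalized approximate Dirac mass `S_ξ^{(n)} = M_{n,d}^{-1/2} R_ξ^{(n)}`. -/
def diracMass (d n : ℕ) (ξ η : Sph d) : ℂ :=
  ((diracKernel d n ξ η / √(normConst d n) : ℝ) : ℂ)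

end SphereFlow

end

open SphereFlow

noncomputable section

namespace SphereFlow

open Polynomial in
/-- The Gegenbauer polynomials `C_k^{(s)}`. -/
def gegenbauer (s : ℝ) : ℕ → Polynomial ℝ
  | 0 => 1
  | 1 => C (2 * s) * X
  | k + 2 => C (1 / (k + 2 : ℝ)) *
      (C (2 * (k + 1 + s)) * X * gegenbauer s (k + 1) - C (k + 2 * s) * gegenbauer s k)

section Gegenbauer

variable (s t : ℝ)

theorem gegenbauer_eval_zero : (gegenbauer s 0).eval t = 1 := by simp [gegenbauer]

theorem gegenbauer_eval_one : (gegenbauer s 1).eval t = 2 * s * t := by simp [gegenbauer]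

theorem gegenbauer_eval_rec (k : ℕ) :
    (k + 2 : ℝ) * (gegenbauer s (k + 2)).eval t =
      2 * (k + 1 + s) * t * (gegenbauer s (k + 1)).eval t -
        (k + 2 * s) * (gegenbauer s k).eval t := by
  have : (k + 2 : ℝ) ≠ 0 := by positivity
  simp only [gegenbauer, Polynomial.eval_mul, Polynomial.eval_sub, Polynomial.eval_C,
    Polynomial.eval_X]
  field_simp

theorem gegenbauer_derivative_rec (k : ℕ) :
    (k + 2 : ℝ) * (gegenbauer s (k + 2)).derivative.eval t =
      2 * (k + 1 + s) * ((gegenbauer s (k + 1)).eval t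
        + t * (gegenbauer s (k + 1)).derivative.eval t) -
        (k + 2 * s) * (gegenbauer s k).derivative.eval t := by
  have : (k + 2 : ℝ) ≠ 0 := by positivity
  simp only [gegenbauer, Polynomial.derivative_mul, Polynomial.derivative_sub,
    Polynomial.derivative_C, Polynomial.derivative_X, Polynomial.eval_mul, Polynomial.eval_sub,
    Polynomial.eval_C, Polynomial.eval_X, Polynomial.eval_add, zero_mul, zero_add, mul_one]
  field_simp

theorem gegenbauer_derivative_aux (k : ℕ) :
    (t * (gegenbauer s (k + 1)).derivative.eval t - (gegenbauer s k).derivative.eval t =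
      (k + 1) * (gegenbauer s (k + 1)).eval t) ∧
    ((gegenbauer s (k + 1)).derivative.eval t - t * (gegenbauer s k).derivative.eval t =
      (k + 2 * s) * (gegenbauer s k).eval t) := by
  induction k with
  | zero => simp [gegenbauer]; ring
  | succ k ih =>
    obtain ⟨hA, hB⟩ := ih
    have hR := gegenbauer_eval_rec s t k
    have hD := gegenbauer_derivative_rec s t k
    have h0 : (k + 2 : ℝ) ≠ 0 := by positivity
    have hB' : (gegenbauer s (k + 2)).derivative.eval t
        - t * (gegenbauer s (k + 1)).derivative.eval t =
        (k + 1 + 2 * s) * (gegenbauer s (k + 1)).eval t := by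
      apply mul_left_cancel₀ h0
      linear_combination hD + (k + 2 * s) * hA
    push_cast
    refine ⟨?_, by linear_combination hB'⟩
    linear_combination t * hB' + t * hA - hB - hR

theorem gegenbauer_ode (k : ℕ) :
    (1 - t ^ 2) * (gegenbauer s k).derivative.derivative.eval t
      - (2 * s + 1) * t * (gegenbauer s k).derivative.eval t
      + k * (k + 2 * s) * (gegenbauer s k).eval t = 0 := by
  have hD : (1 - Polynomial.X ^ 2) * (gegenbauer s k).derivative =
      Polynomial.C (k + 2 * s) * Polynomial.X * gegenbauer s k
        - Polynomial.C (k + 1 : ℝ) * gegenbauer s (k + 1) := by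
    apply Polynomial.funext
    intro r
    simp only [Polynomial.eval_mul, Polynomial.eval_sub, Polynomial.eval_C, Polynomial.eval_X,
      Polynomial.eval_one, Polynomial.eval_pow]
    linear_combination r * (gegenbauer_derivative_aux s r k).2 - (gegenbauer_derivative_aux s r k).1
  have h := congrArg (fun p => Polynomial.eval t p.derivative) hD
  simp only [Polynomial.derivative_mul, Polynomial.derivative_sub, Polynomial.derivative_one,
    Polynomial.derivative_C, Polynomial.derivative_X_pow, Polynomial.derivative_X,
    Polynomial.eval_mul, Polynomial.eval_sub,
    Polynomial.eval_add, Polynomial.eval_C, Polynomial.eval_X, Polynomial.eval_one,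
    Polynomial.eval_zero, Polynomial.eval_pow] at h
  have hB := (gegenbauer_derivative_aux s t k).2
  push_cast at h
  linear_combination h - (k + 1) * hB

end Gegenbauer

/-! ### Taylor coefficients -/

theorem iteratedDeriv_id_mul_zero {f : ℝ → ℝ} {k : ℕ} (hf : ContDiffAt ℝ ∞ f 0) :
    iteratedDeriv (k + 1) (fun r => r * f r) 0 = (k + 1) * iteratedDeriv k f 0 := by
  rw [iteratedDeriv_fun_mul (f := fun r : ℝ => r) contDiffAt_id
    (hf.of_le (mod_cast le_top)), Finset.sum_eq_single 1]
  · simp [iteratedDeriv_one]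
  · intro i _ hi
    rcases i with _ | _ | i
    · simp
    · simp at hi
    · have : iteratedDeriv (i + 2) (fun r : ℝ => r) 0 = 0 := by
        rw [iteratedDeriv_succ', iteratedDeriv_succ']
        simp
      simp [this]
  · simp

theorem contDiffAt_deriv_zero {f : ℝ → ℝ} (hf : ContDiffAt ℝ ∞ f 0) :
    ContDiffAt ℝ ∞ (deriv f) 0 := by
  have : ContDiffAt ℝ ∞ (fun x => fderiv ℝ f x 1) 0 :=
    (hf.fderiv_right (m := ∞) (by simp)).clm_apply contDiffAt_const
  simpa using this

theorem iteratedDeriv_id_mul_deriv_zero {f : ℝ → ℝ} {k : ℕ} (hf : ContDiffAt ℝ ∞ f 0) :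
    iteratedDeriv k (fun r => r * deriv f r) 0 = k * iteratedDeriv k f 0 := by
  rcases k with _ | k
  · simp
  · have hf' : ContDiffAt ℝ ∞ (deriv f) 0 := by
      have : ContDiffAt ℝ ∞ (fun x => fderiv ℝ f x 1) 0 :=
        (hf.fderiv_right (m := ∞) (by simp)).clm_apply contDiffAt_const
      simpa using this
    rw [iteratedDeriv_id_mul_zero hf', iteratedDeriv_succ']
    push_cast; rfl

/-- The generating function of the Gegenbauer polynomials. -/
def gegenbauerGen (s t r : ℝ) : ℝ := (1 + r ^ 2 - 2 * r * t) ^ (-s)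

theorem eventually_generating_base_pos (t : ℝ) : ∀ᶠ r : ℝ in 𝓝 0, 0 < 1 + r ^ 2 - 2 * r * t := by
  have : ContinuousAt (fun r : ℝ => 1 + r ^ 2 - 2 * r * t) 0 := by fun_prop
  exact this.eventually_const_lt (by simp)

theorem contDiffAt_gegenbauerGen (s t : ℝ) : ContDiffAt ℝ ∞ (gegenbauerGen s t) 0 := by
  unfold gegenbauerGen
  refine ContDiffAt.rpow_const_of_ne (by fun_prop) (by simp)

theorem hasDerivAt_gegenbauerGen (s t : ℝ) {r : ℝ} (hr : 0 < 1 + r ^ 2 - 2 * r * t) :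
    HasDerivAt (gegenbauerGen s t)
      (-2 * s * (r - t) * (1 + r ^ 2 - 2 * r * t) ^ (-s - 1)) r := by
  have h : HasDerivAt (fun r : ℝ => 1 + r ^ 2 - 2 * r * t) (2 * r - 2 * t) r := by
    refine (((hasDerivAt_pow 2 r).const_add 1).fun_sub
      (((hasDerivAt_id' r).const_mul 2).mul_const t)).congr_deriv ?_
    simp
  refine (h.rpow_const (p := -s) (Or.inl hr.ne')).congr_deriv ?_
  ring

theorem gegenbauerGen_ode (s t : ℝ) {r : ℝ} (hr : 0 < 1 + r ^ 2 - 2 * r * t) :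
    deriv (gegenbauerGen s t) r + r * (r * deriv (gegenbauerGen s t) r)
      - 2 * t * (r * deriv (gegenbauerGen s t) r) =
      2 * s * t * gegenbauerGen s t r - 2 * s * (r * gegenbauerGen s t r) := by
  rw [(hasDerivAt_gegenbauerGen s t hr).deriv]
  have : gegenbauerGen s t r
      = (1 + r ^ 2 - 2 * r * t) ^ (-s - 1) * (1 + r ^ 2 - 2 * r * t) := by
    rw [Real.rpow_sub_one hr.ne', div_mul_cancel₀ _ hr.ne', gegenbauerGen]
  rw [this]
  ring

theorem iteratedDeriv_gegenbauerGen (s t : ℝ) (k : ℕ) :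
    iteratedDeriv k (gegenbauerGen s t) 0 = k.factorial * (gegenbauer s k).eval t := by
  have hφ := contDiffAt_gegenbauerGen s t
  have hφ' := contDiffAt_deriv_zero hφ
  have h0 : iteratedDeriv 0 (gegenbauerGen s t) 0 = 1 := by simp [gegenbauerGen]
  have h1 : iteratedDeriv 1 (gegenbauerGen s t) 0 = 2 * s * t := by
    rw [iteratedDeriv_one, (hasDerivAt_gegenbauerGen s t (by simp)).deriv]
    simp
  have hrec (k : ℕ) : iteratedDeriv (k + 2) (gegenbauerGen s t) 0 =
      (2 * (k + 1 + s) * t) * iteratedDeriv (k + 1) (gegenbauerGen s t) 0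
        - (k + 1) * (k + 2 * s) * iteratedDeriv k (gegenbauerGen s t) 0 := by
    have hc (j : ℕ) {f : ℝ → ℝ} (hf : ContDiffAt ℝ ∞ f 0) : ContDiffAt ℝ j f 0 :=
      hf.of_le (mod_cast le_top)
    have he := Filter.EventuallyEq.iteratedDeriv_eq (k + 1) (x := (0 : ℝ))
      ((eventually_generating_base_pos t).mono fun r hr => gegenbauerGen_ode s t hr)
    have hid : ContDiffAt ℝ ∞ (fun r : ℝ => r) 0 := contDiffAt_id
    have hrφ' : ContDiffAt ℝ ∞ (fun r => r * deriv (gegenbauerGen s t) r) 0 := hid.mul hφ'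
    have hrφ : ContDiffAt ℝ ∞ (fun r => r * gegenbauerGen s t r) 0 := hid.mul hφ
    rw [iteratedDeriv_fun_sub (hc _ (hφ'.add (hid.mul hrφ'))) (hc _ (contDiffAt_const.mul hrφ')),
      iteratedDeriv_fun_add (hc _ hφ') (hc _ (hid.mul hrφ')),
      iteratedDeriv_id_mul_zero hrφ', iteratedDeriv_id_mul_deriv_zero hφ,
      iteratedDeriv_fun_sub (hc _ (contDiffAt_const.mul hφ)) (hc _ (contDiffAt_const.mul hrφ)),
      iteratedDeriv_const_mul_field, iteratedDeriv_const_mul_field, iteratedDeriv_const_mul_field,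
      iteratedDeriv_id_mul_deriv_zero hφ, iteratedDeriv_id_mul_zero hφ, ← iteratedDeriv_succ'] at he
    push_cast at he
    linear_combination he
  induction k using Nat.twoStepInduction with
  | zero => simp [h0, gegenbauer_eval_zero]
  | one => simp [h1, gegenbauer_eval_one]
  | more k ih ih1 =>
    rw [hrec, ih, ih1, Nat.factorial_succ (k + 1), Nat.factorial_succ k]
    push_cast
    linear_combination -((k + 1 : ℝ) * k.factorial) * gegenbauer_eval_rec s t k

/-! ### Zonal polynomials -/

/-- The index `(d - 2) / 2` of the Gegenbauer polynomials belonging to the sphere of `ℝ^d`. -/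
def gegIndex (d : ℕ) : ℝ := ((d : ℝ) - 2) / 2

/-- The polynomial `N_{k,d} P_{k,d}`. -/
def zonalPoly (d k : ℕ) : Polynomial ℝ :=
  Polynomial.C ((k + gegIndex d) / gegIndex d) * gegenbauer (gegIndex d) k

theorem gegIndex_pos {d : ℕ} (hd : 3 ≤ d) : 0 < gegIndex d := by
  have : (3 : ℝ) ≤ d := by exact_mod_cast hd
  unfold gegIndex
  linarith

theorem iteratedDeriv_spherePoisson {d : ℕ} (hd : 3 ≤ d) (k : ℕ) (t : ℝ) :
    iteratedDeriv k (spherePoisson d t) 0 = k.factorial * (zonalPoly d k).eval t := by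
  have hs := gegIndex_pos hd
  set s := gegIndex d with hsd
  have hφ := contDiffAt_gegenbauerGen s t
  have he : spherePoisson d t =ᶠ[𝓝 0]
      fun r => gegenbauerGen s t r + 1 / s * (r * deriv (gegenbauerGen s t) r) := by
    filter_upwards [eventually_generating_base_pos t] with r hr
    rw [(hasDerivAt_gegenbauerGen s t hr).deriv, gegenbauerGen, spherePoisson,
      show (d : ℝ) / 2 = -(-s - 1) by rw [hsd, gegIndex]; ring, Real.rpow_neg hr.le, div_inv_eq_mul,
      show -s = -s - 1 + 1 by ring, Real.rpow_add_one hr.ne',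
      show -s - 1 + 1 - 1 = -s - 1 by ring]
    field_simp
    ring
  have hc {f : ℝ → ℝ} (hf : ContDiffAt ℝ ∞ f 0) : ContDiffAt ℝ k f 0 :=
    hf.of_le (mod_cast le_top)
  have hid : ContDiffAt ℝ ∞ (fun r : ℝ => r) 0 := contDiffAt_id
  rw [he.iteratedDeriv_eq,
    iteratedDeriv_fun_add (hc hφ)
      (hc (contDiffAt_const.mul (hid.mul (contDiffAt_deriv_zero hφ)))),
    iteratedDeriv_const_mul_field, iteratedDeriv_id_mul_deriv_zero hφ,
    iteratedDeriv_gegenbauerGen, zonalPoly, ← hsd]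
  simp only [Polynomial.eval_mul, Polynomial.eval_C]
  field_simp
  ring

theorem zonalPoly_zero {d : ℕ} (hd : 3 ≤ d) : zonalPoly d 0 = 1 := by
  have := (gegIndex_pos hd).ne'
  simp [zonalPoly, gegenbauer, this]

/-- The upper coefficient of multiplication by `X` in the basis of zonal polynomials. -/
def zonalUp (d k : ℕ) : ℝ := (k + 1) / (2 * k + d)

/-- The lower coefficient of multiplication by `X` in the basis of zonal polynomials. -/
def zonalDown (d k : ℕ) : ℝ := (k + d - 2) / (2 * k + d - 2)

theorem mul_zonalPoly_zero {d : ℕ} (hd : 3 ≤ d) (t : ℝ) :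
    t * (zonalPoly d 0).eval t = zonalUp d 0 * (zonalPoly d 1).eval t := by
  have hs := gegIndex_pos hd
  have h : (d : ℝ) = 2 * gegIndex d + 2 := by unfold gegIndex; ring
  rw [zonalUp, h]
  simp only [zonalPoly, Polynomial.eval_mul, Polynomial.eval_C, gegenbauer_eval_zero,
    gegenbauer_eval_one]
  push_cast
  field_simp
  ring

theorem mul_zonalPoly_succ {d : ℕ} (hd : 3 ≤ d) (k : ℕ) (t : ℝ) :
    t * (zonalPoly d (k + 1)).eval t =
      zonalUp d (k + 1) * (zonalPoly d (k + 2)).eval t +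
        zonalDown d k * (zonalPoly d k).eval t := by
  have hs := gegIndex_pos hd
  have h : (d : ℝ) = 2 * gegIndex d + 2 := by unfold gegIndex; ring
  have hr := gegenbauer_eval_rec (gegIndex d) t k
  rw [zonalUp, zonalDown, h]
  simp only [zonalPoly, Polynomial.eval_mul, Polynomial.eval_C]
  push_cast
  have h1 : (k + gegIndex d) ≠ 0 := by positivity
  have h2 : (k + 1 + gegIndex d) ≠ 0 := by positivity
  have h3 : (k + 2 + gegIndex d) ≠ 0 := by positivity
  rw [show 2 * (k + 1 : ℝ) + (2 * gegIndex d + 2) = 2 * (k + 2 + gegIndex d) by ring,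
    show k + (2 * gegIndex d + 2) - 2 = k + 2 * gegIndex d by ring,
    show 2 * (k : ℝ) + (2 * gegIndex d + 2) - 2 = 2 * (k + gegIndex d) by ring]
  field_simp
  linear_combination -hr

theorem zonalPoly_ode {d : ℕ} (k : ℕ) (t : ℝ) :
    (1 - t ^ 2) * (zonalPoly d k).derivative.derivative.eval t
      - (d - 1) * t * (zonalPoly d k).derivative.eval t =
      -(k * (k + d - 2)) * (zonalPoly d k).eval t := by
  have h : (d : ℝ) = 2 * gegIndex d + 2 := by unfold gegIndex; ring
  have := gegenbauer_ode (gegIndex d) t k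
  simp only [zonalPoly, Polynomial.derivative_C_mul, Polynomial.eval_mul, Polynomial.eval_C]
  rw [h] at *
  linear_combination ((k + gegIndex d) / gegIndex d) * this

/-! ### Dimensions of the spaces of spherical harmonics -/

theorem harmDim_zero {d : ℕ} (hd : 3 ≤ d) : harmDim d 0 = 1 := by
  obtain ⟨m, rfl⟩ := Nat.exists_eq_add_of_le' hd
  have : ((m + 1).factorial : ℝ) = (m + 1) * m.factorial := by
    rw [Nat.factorial_succ]; push_cast; rfl
  have h0 : (m.factorial : ℝ) ≠ 0 := by positivity
  have h1 : (m + 1 : ℝ) ≠ 0 := by positivity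
  simp only [harmDim, show 0 + (m + 3) - 3 = m by omega, show m + 3 - 2 = m + 1 by omega, this]
  push_cast
  field_simp
  simp
  ring

theorem harmDim_pos {d : ℕ} (hd : 3 ≤ d) (k : ℕ) : 0 < harmDim d k := by
  have : (3 : ℝ) ≤ d := by exact_mod_cast hd
  have h : 0 < (2 * k + d - 2 : ℝ) := by
    have : (0 : ℝ) ≤ k := by positivity
    linarith
  unfold harmDim
  positivity

theorem harmDim_succ {d : ℕ} (hd : 3 ≤ d) (k : ℕ) :
    zonalUp d k * harmDim d (k + 1) = zonalDown d k * harmDim d k := by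
  obtain ⟨m, rfl⟩ := Nat.exists_eq_add_of_le' hd
  simp only [harmDim, zonalUp, zonalDown, show k + 1 + (m + 3) - 3 = k + m + 1 by omega,
    show k + (m + 3) - 3 = k + m by omega, Nat.factorial_succ]
  push_cast
  have h0 : (k + 1 : ℝ) ≠ 0 := by positivity
  have h1 : (2 * k + (m + 3) : ℝ) ≠ 0 := by positivity
  have h2 : (2 * k + m + 1 : ℝ) ≠ 0 := by positivity
  rw [show (2 * (k + 1 : ℝ) + (m + 3) - 2) = 2 * k + (m + 3) by ring,
    show (2 * k + (m + 3) - 2 : ℝ) = 2 * k + m + 1 by ring,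
    show (k + (m + 3) - 2 : ℝ) = k + m + 1 by ring]
  field_simp

theorem zonalDown_succ_add_zonalUp {d : ℕ} (hd : 3 ≤ d) (k : ℕ) :
    zonalDown d (k + 1) + zonalUp d k = 1 := by
  have : (3 : ℝ) ≤ d := by exact_mod_cast hd
  have h : 0 < (2 * k + d : ℝ) := by positivity
  simp only [zonalUp, zonalDown]
  push_cast
  rw [show 2 * (k + 1 : ℝ) + d - 2 = 2 * k + d by ring]
  field_simp
  ring

theorem zonalUp_pos {d : ℕ} (hd : 3 ≤ d) (k : ℕ) : 0 < zonalUp d k := by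
  have : 0 < (d : ℝ) := by exact_mod_cast (by omega : 0 < d)
  unfold zonalUp
  positivity

theorem zonalDown_pos {d : ℕ} (hd : 3 ≤ d) (k : ℕ) : 0 < zonalDown d k := by
  have : (3 : ℝ) ≤ d := by exact_mod_cast hd
  have : (0 : ℝ) ≤ k := by positivity
  exact div_pos (by linarith) (by linarith)

theorem zonalPoly_eval_of_sq_eq_one {d : ℕ} (hd : 3 ≤ d) {t : ℝ} (ht : t ^ 2 = 1) (k : ℕ) :
    (zonalPoly d k).eval t = t ^ k * harmDim d k := by
  have hup (k) := (zonalUp_pos hd k).ne'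
  induction k using Nat.twoStepInduction with
  | zero => simp [zonalPoly_zero hd, harmDim_zero hd]
  | one =>
    apply mul_left_cancel₀ (hup 0)
    rw [← mul_zonalPoly_zero hd, zonalPoly_zero hd]
    have := harmDim_succ hd 0
    have hdn : zonalDown d 0 = 1 := by
      have : (3 : ℝ) ≤ d := by exact_mod_cast hd
      simp only [zonalDown]
      push_cast
      rw [div_eq_one_iff_eq (by linarith)]
      ring
    rw [harmDim_zero hd, hdn] at this
    simp only [Polynomial.eval_one]
    linear_combination -t * this
  | more k ih ih1 =>
    apply mul_left_cancel₀ (hup (k + 1))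
    have h := mul_zonalPoly_succ hd k t
    rw [ih, ih1] at h
    linear_combination -h + t ^ k * harmDim_succ hd k - t ^ (k + 2) * harmDim_succ hd (k + 1)
      - t ^ (k + 2) * harmDim d (k + 1) * zonalDown_succ_add_zonalUp hd k
      + t ^ k * harmDim d (k + 1) * zonalUp d k * ht

theorem legendre_mul_harmDim {d : ℕ} (hd : 3 ≤ d) (k : ℕ) (t : ℝ) :
    harmDim d k * legendre d k t = (zonalPoly d k).eval t := by
  have h0 : (k.factorial : ℝ) ≠ 0 := by positivity
  have h1 := (harmDim_pos hd k).ne'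
  rw [legendre, iteratedDeriv_spherePoisson hd]
  field_simp

theorem zonal_eq {d : ℕ} (hd : 3 ≤ d) (k : ℕ) (ξ η : Sph d) :
    zonal d k ξ η = (zonalPoly d k).eval (dot ξ η) / (surf d).real Set.univ := by
  rw [zonal, ← legendre_mul_harmDim hd]
  ring

/-! ### Green's formula on the sphere -/

section Euclidean

variable {E : Type*} [NormedAddCommGroup E] [InnerProductSpace ℝ E]

theorem integral_fderiv_apply_eq_zero [FiniteDimensional ℝ E] [MeasurableSpace E] [BorelSpace E] (μ : Measure E)
    [μ.IsAddHaarMeasure] {h : E → ℂ} (hh : ContDiff ℝ 1 h) (hc : HasCompactSupport h) (v : E) :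
    ∫ x, fderiv ℝ h x v ∂μ = 0 := by
  have hd : Differentiable ℝ h := hh.differentiable one_ne_zero
  have hcont : Continuous fun x => fderiv ℝ h x v :=
    (hh.continuous_fderiv one_ne_zero).clm_apply continuous_const
  have hi : Integrable (fun x => fderiv ℝ h x v) μ :=
    hcont.integrable_of_hasCompactSupport (hc.fderiv_apply (𝕜 := ℝ) v)
  have := integral_mul_fderiv_eq_neg_fderiv_mul_of_integrable (μ := μ) (𝕜 := ℂ)
    (f := fun _ : E => (1 : ℂ)) (g := h) (v := v) (by simp) (by simpa using hi)
    (by simpa using hh.continuous.integrable_of_hasCompactSupport hc)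
    (fun x _ => by fun_prop) (fun x _ => hd x)
  simpa using this

theorem laplacian_eq_sum_fderiv [FiniteDimensional ℝ E] {ι : Type*} [Fintype ι] (b : OrthonormalBasis ι ℝ E) (F : E → ℂ)
    (x : E) : (Δ F) x = ∑ i, fderiv ℝ (fderiv ℝ F) x (b i) (b i) := by
  rw [InnerProductSpace.laplacian_eq_iteratedFDeriv_orthonormalBasis F b]
  simp [iteratedFDeriv_two_apply]

/-- The Green vector field of two functions, cut off by `X`. -/
def greenField (X : E → ℝ) (F G : E → ℂ) (v x : E) : ℂ :=
  (X x : ℂ) * (G x * fderiv ℝ F x v - F x * fderiv ℝ G x v)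

theorem fderiv_greenField {X : E → ℝ} {F G : E → ℂ} {v x : E} (hX : DifferentiableAt ℝ X x)
    (hF : ContDiffAt ℝ 2 F x) (hG : ContDiffAt ℝ 2 G x) :
    fderiv ℝ (greenField X F G v) x v =
      (fderiv ℝ X x v : ℂ) * (G x * fderiv ℝ F x v - F x * fderiv ℝ G x v) +
        (X x : ℂ) * (G x * fderiv ℝ (fderiv ℝ F) x v v - F x * fderiv ℝ (fderiv ℝ G) x v v) := by
  have key {F : E → ℂ} (hF : ContDiffAt ℝ 2 F x) : HasFDerivAt (fun y => fderiv ℝ F y v)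
      ((fderiv ℝ (fderiv ℝ F) x).flip v) x := by
    have := ((hF.fderiv_right (m := 1) (by norm_num)).differentiableAt
      one_ne_zero).hasFDerivAt
    simpa using this.clm_apply (hasFDerivAt_const v x)
  have hF1 := (hF.differentiableAt two_ne_zero).hasFDerivAt
  have hG1 := (hG.differentiableAt two_ne_zero).hasFDerivAt
  have hXc : HasFDerivAt (fun y => (X y : ℂ)) (Complex.ofRealCLM.comp (fderiv ℝ X x)) x :=
    Complex.ofRealCLM.hasFDerivAt.comp x hX.hasFDerivAt
  have h := hXc.fun_mul ((hG1.fun_mul (key hF)).fun_sub (hF1.fun_mul (key hG)))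
  have h' : fderiv ℝ (greenField X F G v) x = _ := h.fderiv
  rw [h']
  simp
  ring

/-- A smooth radial cutoff function supported in an annulus. -/
def annulusBump : ContDiffBump (2 : ℝ) := ⟨1 / 2, 1, by norm_num, by norm_num⟩

theorem contDiff_annulusBump_norm_sq : ContDiff ℝ ∞ fun x : E => annulusBump (‖x‖ ^ 2) :=
  annulusBump.contDiff.comp (contDiff_norm_sq ℝ)

theorem annulusBump_norm_sq_eventually_zero {E : Type*} [NormedAddCommGroup E] :
    ∀ᶠ x : E in 𝓝 0, annulusBump (‖x‖ ^ 2) = 0 := by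
  have : ContinuousAt (fun x : E => ‖x‖ ^ 2) 0 := by fun_prop
  filter_upwards [this.eventually_lt_const (show ‖(0 : E)‖ ^ 2 < 1 by simp)] with x hx
  apply annulusBump.zero_of_le_dist
  rw [Real.dist_eq, abs_of_neg (by linarith)]
  change (1 : ℝ) ≤ _
  linarith

theorem hasCompactSupport_annulusBump_norm_sq [FiniteDimensional ℝ E] :
    HasCompactSupport fun x : E => annulusBump (‖x‖ ^ 2) := by
  refine HasCompactSupport.intro (isCompact_closedBall (0 : E) 2) fun x hx => ?_
  rw [mem_closedBall_zero_iff, not_le] at hx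
  apply annulusBump.zero_of_le_dist
  change (1 : ℝ) ≤ _
  rw [Real.dist_eq, abs_of_pos (by nlinarith)]
  nlinarith

theorem integral_green_euclidean [FiniteDimensional ℝ E] [MeasurableSpace E] [BorelSpace E] (μ : Measure E)
    [μ.IsAddHaarMeasure] {F G : E → ℂ} (hF : ContDiffOn ℝ ∞ F {0}ᶜ) (hG : ContDiffOn ℝ ∞ G {0}ᶜ)
    (hF0 : ∀ x ≠ 0, fderiv ℝ F x x = 0) (hG0 : ∀ x ≠ 0, fderiv ℝ G x x = 0) :
    ∫ x, ((‖x‖ ^ 2 * annulusBump (‖x‖ ^ 2) : ℝ) : ℂ) * (G x * (Δ F) x - F x * (Δ G) x) ∂μ = 0 := by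
  set X : E → ℝ := fun x => ‖x‖ ^ 2 * annulusBump (‖x‖ ^ 2) with hXdef
  have hX : ContDiff ℝ ∞ X := (contDiff_norm_sq ℝ).mul contDiff_annulusBump_norm_sq
  have hX0 : ∀ᶠ x : E in 𝓝 0, X x = 0 := by
    filter_upwards [annulusBump_norm_sq_eventually_zero] with x hx
    simp [hXdef, hx]
  have hat {F : E → ℂ} (hF : ContDiffOn ℝ ∞ F {0}ᶜ) {x : E} (hx : x ≠ 0) : ContDiffAt ℝ ∞ F x :=
    hF.contDiffAt (isOpen_compl_singleton.mem_nhds hx)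
  have hW0 (v : E) : greenField X F G v =ᶠ[𝓝 0] fun _ => 0 := by
    filter_upwards [hX0] with x hx
    simp [greenField, hx]
  have hW (v : E) : ContDiff ℝ 1 (greenField X F G v) := by
    rw [contDiff_iff_contDiffAt]
    intro x
    by_cases hx : x = 0
    · subst hx
      exact contDiffAt_const.congr_of_eventuallyEq (hW0 v)
    · have key {F : E → ℂ} (hF : ContDiffOn ℝ ∞ F {0}ᶜ) :
          ContDiffAt ℝ 1 (fun y => fderiv ℝ F y v) x :=
        ((hat hF hx).fderiv_right (m := 1) (by norm_cast)).clm_apply contDiffAt_const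
      have h1 {F : E → ℂ} (hF : ContDiffOn ℝ ∞ F {0}ᶜ) : ContDiffAt ℝ 1 F x :=
        (hat hF hx).of_le (by norm_cast)
      have hXc : ContDiffAt ℝ 1 (fun y => (X y : ℂ)) x :=
        (Complex.ofRealCLM.contDiff.comp (hX.of_le (by norm_cast))).contDiffAt
      exact hXc.mul (((h1 hG).mul (key hF)).sub ((h1 hF).mul (key hG)))
  have hWc (v : E) : HasCompactSupport (greenField X F G v) := by
    refine hasCompactSupport_annulusBump_norm_sq.mono fun x hx => ?_
    rw [Function.mem_support] at hx ⊢
    intro h0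
    exact hx (by simp [greenField, hXdef, h0])
  let b := stdOrthonormalBasis ℝ E
  have hsum : ∀ x, (X x : ℂ) * (G x * (Δ F) x - F x * (Δ G) x) =
      ∑ i, fderiv ℝ (greenField X F G (b i)) x (b i) := by
    intro x
    by_cases hx : x = 0
    · subst hx
      simp [(hW0 _).fderiv_eq, hX0.self_of_nhds]
    · have h2 {F : E → ℂ} (hF : ContDiffOn ℝ ∞ F {0}ᶜ) : ContDiffAt ℝ 2 F x :=
        (hat hF hx).of_le (by norm_cast)
      have hφ : HasDerivAt annulusBump (deriv annulusBump (‖x‖ ^ 2)) (‖x‖ ^ 2) :=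
        ((annulusBump.contDiff (n := 1)).differentiable one_ne_zero _).hasDerivAt
      obtain ⟨c, hXd⟩ : ∃ c : ℝ, HasFDerivAt X (c • innerSL ℝ x) x := by
        have h := ((hasDerivAt_id' _).fun_mul hφ).comp_hasFDerivAt (f := fun x : E => ‖x‖ ^ 2) x
          (hasStrictFDerivAt_norm_sq x).hasFDerivAt
        rw [← Nat.cast_smul_eq_nsmul ℝ, smul_smul] at h
        exact ⟨_, h⟩
      have hcross {F : E → ℂ} (h0 : fderiv ℝ F x x = 0) :
          ∑ i, (fderiv ℝ X x (b i) : ℂ) * fderiv ℝ F x (b i) = 0 := by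
        have hx' : fderiv ℝ F x (∑ i, inner ℝ (b i) x • b i) = 0 := by
          rw [b.sum_repr']; exact h0
        rw [map_sum] at hx'
        simp only [map_smul, Complex.real_smul] at hx'
        simp only [hXd.fderiv, smul_apply, innerSL_apply_apply, smul_eq_mul]
        simp only [real_inner_comm x] at hx'
        calc _ = (c : ℂ) *
              ∑ i, ((inner ℝ x (b i) : ℝ) : ℂ) * fderiv ℝ F x (b i) := by
              rw [Finset.mul_sum]
              refine Finset.sum_congr rfl fun i _ => ?_
              push_cast
              ring
          _ = 0 := by rw [hx', mul_zero]
      simp only [fderiv_greenField (hX.differentiable (by simp) x) (h2 hF) (h2 hG)]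
      rw [laplacian_eq_sum_fderiv b F, laplacian_eq_sum_fderiv b G]
      have e1 := hcross (hF0 x hx)
      have e2 := hcross (hG0 x hx)
      have : ∀ i, (fderiv ℝ X x (b i) : ℂ) * (G x * fderiv ℝ F x (b i) - F x * fderiv ℝ G x (b i)) +
          (X x : ℂ) * (G x * fderiv ℝ (fderiv ℝ F) x (b i) (b i)
            - F x * fderiv ℝ (fderiv ℝ G) x (b i) (b i)) =
          G x * ((fderiv ℝ X x (b i) : ℂ) * fderiv ℝ F x (b i))
          - F x * ((fderiv ℝ X x (b i) : ℂ) * fderiv ℝ G x (b i))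
          + (X x : ℂ) * (G x * fderiv ℝ (fderiv ℝ F) x (b i) (b i)
            - F x * fderiv ℝ (fderiv ℝ G) x (b i) (b i)) := fun i => by ring
      simp only [this, Finset.sum_add_distrib, Finset.sum_sub_distrib, ← Finset.mul_sum, e1, e2]
      ring
  have hint (v : E) : Integrable (fun x => fderiv ℝ (greenField X F G v) x v) μ :=
    Continuous.integrable_of_hasCompactSupport
      (((hW v).continuous_fderiv one_ne_zero).clm_apply continuous_const)
      ((hWc v).fderiv_apply (𝕜 := ℝ) v)
  simp only [hXdef] at hsum
  simp only [hsum]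
  rw [integral_finsetSum _ fun i _ => hint (b i)]
  exact Finset.sum_eq_zero fun i _ => integral_fderiv_apply_eq_zero μ (hW _) (hWc _) _

end Euclidean

/-! ### Radial extensions -/

section Radial

variable {d : ℕ}

theorem radialExt_of_ne (f : Sph d → ℂ) {x : EuclideanSpace ℝ (Fin d)} (hx : x ≠ 0) :
    radialExt f x = f (homeomorphUnitSphereProd (EuclideanSpace ℝ (Fin d)) ⟨x, hx⟩).1 := by
  rw [radialExt, dif_neg hx]
  congr 1
  ext1
  simp

theorem radialExt_zero (f : Sph d → ℂ) : radialExt f 0 = 0 := by simp [radialExt]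

theorem sph_ne_zero (η : Sph d) : (η : EuclideanSpace ℝ (Fin d)) ≠ 0 := by
  intro h
  have := norm_eq_of_mem_sphere η
  simp [h] at this

theorem radialExt_smul (f : Sph d → ℂ) {c : ℝ} (hc : 0 < c) (x : EuclideanSpace ℝ (Fin d)) :
    radialExt f (c • x) = radialExt f x := by
  by_cases hx : x = 0
  · simp [hx]
  · rw [radialExt, radialExt, dif_neg hx, dif_neg (smul_ne_zero hc.ne' hx)]
    congr 1
    ext1
    simp only [norm_smul, Real.norm_of_nonneg hc.le, smul_smul]
    congr 1
    field_simp

theorem laplacian_radialExt_smul (f : Sph d → ℂ) {c : ℝ} (hc : 0 < c)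
    (x : EuclideanSpace ℝ (Fin d)) :
    (Δ (radialExt f)) x = (c : ℂ) ^ 2 * (Δ (radialExt f)) (c • x) := by
  have h1 : fderiv ℝ (radialExt f) = fun x => c • fderiv ℝ (radialExt f) (c • x) := by
    ext1 x
    rw [← fderiv_comp_smul]
    congr 1
    ext1 y
    exact (radialExt_smul f hc y).symm
  have h2 (x) : fderiv ℝ (fderiv ℝ (radialExt f)) x
      = c • c • fderiv ℝ (fderiv ℝ (radialExt f)) (c • x) := by
    conv_lhs => rw [h1]
    rw [← fderiv_comp_smul (f := fderiv ℝ (radialExt f))]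
    exact congrFun (fderiv_const_smul_field (𝕜 := ℝ) (f := fun x => fderiv ℝ (radialExt f) (c • x)) c) x
  let b := stdOrthonormalBasis ℝ (EuclideanSpace ℝ (Fin d))
  rw [laplacian_eq_sum_fderiv b, laplacian_eq_sum_fderiv b, Finset.mul_sum]
  refine Finset.sum_congr rfl fun i _ => ?_
  rw [h2]
  simp
  ring

theorem laplacian_radialExt (f : Sph d → ℂ) {x : EuclideanSpace ℝ (Fin d)} (hx : x ≠ 0) :
    (‖x‖ ^ 2 : ℝ) * (Δ (radialExt f)) x = radialExt (sphereLaplacian f) x := by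
  have h0 : 0 < ‖x‖ := norm_pos_iff.mpr hx
  rw [laplacian_radialExt_smul f (inv_pos.mpr h0), radialExt, dif_neg hx, sphereLaplacian]
  push_cast
  have : (‖x‖ : ℂ) ≠ 0 := by exact_mod_cast h0.ne'
  field_simp

theorem fderiv_radialExt_self (f : Sph d → ℂ) (hf : SmoothOnSphere f)
    {x : EuclideanSpace ℝ (Fin d)} (hx : x ≠ 0) : fderiv ℝ (radialExt f) x x = 0 := by
  have hd : HasFDerivAt (radialExt f) (fderiv ℝ (radialExt f) x) ((1 : ℝ) • x) := by
    rw [one_smul]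
    exact ((hf.contDiffAt (isOpen_compl_singleton.mem_nhds hx)).differentiableAt
      (by simp)).hasFDerivAt
  have hl : HasDerivAt (fun c : ℝ => c • x) x 1 := by
    simpa using (hasDerivAt_id (1 : ℝ)).smul_const x
  have h1 := hd.comp_hasDerivAt (1 : ℝ) hl
  have h2 : HasDerivAt (radialExt f ∘ fun c : ℝ => c • x) 0 1 := by
    refine (hasDerivAt_const (1 : ℝ) (radialExt f x)).congr_of_eventuallyEq ?_
    filter_upwards [lt_mem_nhds (show (0 : ℝ) < 1 by norm_num)] with c hc
    exact radialExt_smul f hc x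
  exact h1.unique h2

/-- Integration in polar coordinates of the product of a radial function and a function that is
constant on rays. -/
theorem integral_radial_mul_radialExt (hd : 0 < d) (ρ : ℝ → ℂ) (f : Sph d → ℂ) :
    ∫ x : EuclideanSpace ℝ (Fin d), ρ ‖x‖ * radialExt f x =
      (∫ η, f η ∂(surf d)) * ∫ r : Set.Ioi (0 : ℝ), ρ r ∂(Measure.volumeIoiPow (d - 1)) := by
  have : Nonempty (Fin d) := ⟨⟨0, hd⟩⟩
  let E := EuclideanSpace ℝ (Fin d)
  calc _ = ∫ x : ({(0)}ᶜ : Set E), ρ ‖x.1‖ * radialExt f x.1 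
          ∂((volume : Measure E).comap Subtype.val) := by
        rw [integral_subtype_comap (measurableSet_singleton _).compl
          fun x : E => ρ ‖x‖ * radialExt f x, restrict_compl_singleton]
    _ = ∫ x, f x.1 * ρ x.2 ∂(surf d).prod (.volumeIoiPow (Module.finrank ℝ E - 1)) := by
        rw [← (volume : Measure E).measurePreserving_homeomorphUnitSphereProd.integral_comp
          (Homeomorph.measurableEmbedding _)]
        refine integral_congr_ae (.of_forall fun x => ?_)
        obtain ⟨x, hx⟩ := x
        simp only
        rw [radialExt_of_ne f hx, mul_comm]
        simp only [homeomorphUnitSphereProd_apply_snd_coe]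
        rfl
    _ = _ := by
        rw [finrank_euclideanSpace_fin]
        exact integral_prod_mul f fun r : Set.Ioi (0 : ℝ) => ρ r

theorem integral_green_sphere (hd : 0 < d) {f g : Sph d → ℂ} (hf : SmoothOnSphere f)
    (hg : SmoothOnSphere g) :
    ∫ η, (g η * sphereLaplacian f η - f η * sphereLaplacian g η) ∂(surf d) = 0 := by
  have : Nonempty (Fin d) := ⟨⟨0, hd⟩⟩
  have h := integral_green_euclidean volume hf hg (fun x hx => fderiv_radialExt_self f hf hx)
    (fun x hx => fderiv_radialExt_self g hg hx)
  have e1 := integral_radial_mul_radialExt hd (fun r => (annulusBump (r ^ 2) : ℂ))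
    (fun η => g η * sphereLaplacian f η - f η * sphereLaplacian g η)
  have e2 := integral_radial_mul_radialExt hd (fun r => (annulusBump (r ^ 2) : ℂ)) (fun _ => 1)
  have hne : ∫ x : EuclideanSpace ℝ (Fin d),
      (annulusBump (‖x‖ ^ 2) : ℂ) * radialExt (fun _ => 1) x ≠ 0 := by
    have hpos : 0 < ∫ x : EuclideanSpace ℝ (Fin d), annulusBump (‖x‖ ^ 2) := by
      obtain ⟨x, hx⟩ := exists_norm_eq (EuclideanSpace ℝ (Fin d)) (Real.sqrt_nonneg 2)
      refine Continuous.integral_pos_of_hasCompactSupport_nonneg_nonzero (x := x)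
        (contDiff_annulusBump_norm_sq.continuous) hasCompactSupport_annulusBump_norm_sq
        (fun x => annulusBump.nonneg) ?_
      rw [hx, Real.sq_sqrt zero_le_two]
      have := annulusBump.one_of_mem_closedBall
        (Metric.mem_closedBall_self annulusBump.rIn_pos.le)
      simp [this]
    have : ∀ x : EuclideanSpace ℝ (Fin d), (annulusBump (‖x‖ ^ 2) : ℂ) * radialExt (fun _ => 1) x
        = ((annulusBump (‖x‖ ^ 2) : ℝ) : ℂ) := by
      intro x
      by_cases hx : x = 0
      · rw [hx, annulusBump_norm_sq_eventually_zero.self_of_nhds]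
        simp
      · rw [radialExt_of_ne _ hx, mul_one]
    simp only [this]
    rw [integral_complex_ofReal]
    exact_mod_cast hpos.ne'
  rw [e2] at hne
  have h3 : ∫ x : EuclideanSpace ℝ (Fin d), (annulusBump (‖x‖ ^ 2) : ℂ) * radialExt
      (fun η => g η * sphereLaplacian f η - f η * sphereLaplacian g η) x = 0 := by
    rw [← h]
    refine integral_congr_ae (.of_forall fun x => ?_)
    simp only
    by_cases hx : x = 0
    · simp [hx, radialExt_zero]
    · have hLf := laplacian_radialExt f hx
      have hLg := laplacian_radialExt g hx
      rw [radialExt_of_ne _ hx] at hLf hLg ⊢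
      rw [← hLf, ← hLg, ← radialExt_of_ne f hx, ← radialExt_of_ne g hx]
      push_cast
      ring
  rw [e1] at h3
  exact (mul_eq_zero.mp h3).resolve_right (right_ne_zero_of_mul hne)

theorem integral_mul_eq_zero_of_eigenfunctions (hd : 0 < d) {f g : Sph d → ℂ}
    (hf : SmoothOnSphere f) (hg : SmoothOnSphere g) {lam mu : ℝ} (hne : lam ≠ mu)
    (hLf : ∀ η, sphereLaplacian f η = -(lam : ℂ) * f η)
    (hLg : ∀ η, sphereLaplacian g η = -(mu : ℂ) * g η) :
    ∫ η, f η * g η ∂(surf d) = 0 := by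
  have h := integral_green_sphere hd hf hg
  have : ∀ η, g η * sphereLaplacian f η - f η * sphereLaplacian g η
      = ((mu - lam : ℝ) : ℂ) * (f η * g η) := by
    intro η
    rw [hLf, hLg]
    push_cast
    ring
  simp only [this, integral_const_mul] at h
  exact (mul_eq_zero.mp h).resolve_left (by exact_mod_cast sub_ne_zero.mpr hne.symm)

end Radial

/-! ### Zonal functions -/

section Zonal

theorem fderiv_fderiv_eq_deriv_deriv {E : Type*} [NormedAddCommGroup E] [NormedSpace ℝ E]
    {F : E → ℂ} {x : E} (hF : ContDiffAt ℝ 2 F x) (v : E) :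
    fderiv ℝ (fderiv ℝ F) x v v = deriv (deriv fun s : ℝ => F (x + s • v)) 0 := by
  have hl (s : ℝ) : HasDerivAt (fun s : ℝ => x + s • v) v s := by
    simpa using ((hasDerivAt_id s).smul_const v).const_add x
  have hx0 : x + (0 : ℝ) • v = x := by simp
  have he : deriv (fun s : ℝ => F (x + s • v)) =ᶠ[𝓝 0] fun s => fderiv ℝ F (x + s • v) v := by
    have h1 : ∀ᶠ y in 𝓝 x, DifferentiableAt ℝ F y :=
      (hF.eventually (by simp)).mono fun y hy => hy.differentiableAt two_ne_zero
    have h2 : Tendsto (fun s : ℝ => x + s • v) (𝓝 0) (𝓝 x) := by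
      have := (hl 0).continuousAt.tendsto
      rwa [hx0] at this
    filter_upwards [h2.eventually h1] with s hs
    exact (hs.hasFDerivAt.comp_hasDerivAt s (hl s)).deriv
  rw [he.deriv_eq]
  have h3 : HasFDerivAt (fderiv ℝ F) (fderiv ℝ (fderiv ℝ F) x) (x + (0 : ℝ) • v) := by
    rw [hx0]
    exact ((hF.fderiv_right (m := 1) (by norm_num)).differentiableAt one_ne_zero).hasFDerivAt
  have h5 : HasFDerivAt (fun y => fderiv ℝ F y v) ((fderiv ℝ (fderiv ℝ F) x).flip v)
      (x + (0 : ℝ) • v) := by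
    simpa using h3.clm_apply (hasFDerivAt_const v _)
  have h4 := h5.comp_hasDerivAt (0 : ℝ) (hl 0)
  exact h4.deriv.symm

theorem deriv_deriv_eval_normalized_line (q : Polynomial ℝ) (t a b : ℝ) :
    deriv (deriv fun s : ℝ =>
      ((q.eval ((t + s * a) * (1 + 2 * b * s + s ^ 2) ^ (-(1 / 2) : ℝ)) : ℝ) : ℂ)) 0 =
    ((q.derivative.derivative.eval t * (a - t * b) ^ 2
      + q.derivative.eval t * (-2 * (a * b) - t + 3 * t * b ^ 2) : ℝ) : ℂ) := by
  set w : ℝ → ℝ := fun s => 1 + 2 * b * s + s ^ 2 with hw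
  have hw0 : w 0 = 1 := by simp [hw]
  have hwd (s : ℝ) : HasDerivAt w (2 * b + 2 * s) s := by
    refine ((((hasDerivAt_id' s).const_mul (2 * b)).const_add 1).fun_add
      (hasDerivAt_pow 2 s)).congr_deriv ?_
    simp
  have hwp {s : ℝ} (hs : 0 < w s) (p : ℝ) :
      HasDerivAt (fun s => w s ^ p) ((2 * b + 2 * s) * p * w s ^ (p - 1)) s :=
    (hwd s).rpow_const (Or.inl hs.ne')
  have hline (s : ℝ) : HasDerivAt (fun s : ℝ => t + s * a) a s := by
    simpa using ((hasDerivAt_id s).mul_const a).const_add t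
  set ψ : ℝ → ℝ := fun s => (t + s * a) * w s ^ (-(1 / 2) : ℝ) with hψ
  set ψ' : ℝ → ℝ := fun s => a * w s ^ (-(1 / 2) : ℝ)
    - (t + s * a) * (b + s) * w s ^ (-(3 / 2) : ℝ) with hψ'
  have hψd {s : ℝ} (hs : 0 < w s) : HasDerivAt ψ (ψ' s) s := by
    refine ((hline s).fun_mul (hwp hs _)).congr_deriv ?_
    rw [hψ', show (-(1 / 2) - 1 : ℝ) = -(3 / 2) by norm_num]
    ring
  have hψ'd : HasDerivAt ψ' (-2 * (a * b) - t + 3 * t * b ^ 2) 0 := by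
    have hb : HasDerivAt (fun s : ℝ => b + s) 1 0 := (hasDerivAt_id' (0 : ℝ)).const_add b
    have h1 := hwp (s := 0) (by rw [hw0]; norm_num)
    refine (((h1 (-(1 / 2))).const_mul a).fun_sub (((hline 0).fun_mul hb).fun_mul
      (h1 (-(3 / 2))))).congr_deriv ?_
    simp only [hw0, Real.one_rpow]
    ring
  have hev : ∀ᶠ s in 𝓝 (0 : ℝ), 0 < w s :=
    (hwd 0).continuousAt.eventually_const_lt (by rw [hw0]; norm_num)
  have he : (deriv fun s : ℝ => ((q.eval (ψ s) : ℝ) : ℂ)) =ᶠ[𝓝 0]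
      fun s => ((q.derivative.eval (ψ s) * ψ' s : ℝ) : ℂ) := by
    filter_upwards [hev] with s hs
    exact (((q.hasDerivAt (ψ s)).comp s (hψd hs)).ofReal_comp).deriv
  rw [he.deriv_eq]
  have hψ0 : ψ 0 = t := by simp [hψ, hw0]
  have hψ'0 : ψ' 0 = a - t * b := by simp [hψ', hw0]
  have h0 : HasDerivAt ψ (ψ' 0) 0 := hψd (by rw [hw0]; norm_num)
  have h2 := (((q.derivative.hasDerivAt (ψ 0)).comp 0 h0).fun_mul hψ'd).ofReal_comp
  refine h2.deriv.trans ?_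
  simp only [Function.comp_apply, hψ0, hψ'0]
  congr 1
  ring

variable {d : ℕ}

/-- The complex-valued zonal function `η ↦ q (ξ · η)`. -/
def zonalFun (q : Polynomial ℝ) (ξ η : Sph d) : ℂ := ((q.eval (dot ξ η) : ℝ) : ℂ)

theorem radialExt_zonalFun (q : Polynomial ℝ) (ξ : Sph d) {x : EuclideanSpace ℝ (Fin d)}
    (hx : x ≠ 0) : radialExt (zonalFun q ξ) x =
      ((q.eval (inner ℝ (ξ : EuclideanSpace ℝ (Fin d)) x * ‖x‖⁻¹) : ℝ) : ℂ) := by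
  rw [radialExt, dif_neg hx, zonalFun, dot]
  simp only [inner_smul_right]
  rw [mul_comm]

theorem smoothOnSphere_zonalFun (q : Polynomial ℝ) (ξ : Sph d) :
    SmoothOnSphere (zonalFun q ξ) := by
  have h : ContDiffOn ℝ ∞ (fun x : EuclideanSpace ℝ (Fin d) =>
      ((q.eval (inner ℝ (ξ : EuclideanSpace ℝ (Fin d)) x * ‖x‖⁻¹) : ℝ) : ℂ)) {0}ᶜ := by
    intro x hx
    have hx' : x ≠ 0 := hx
    refine ContDiffAt.contDiffWithinAt ?_
    have h1 : ContDiffAt ℝ ∞ (fun x : EuclideanSpace ℝ (Fin d) =>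
        inner ℝ (ξ : EuclideanSpace ℝ (Fin d)) x * ‖x‖⁻¹) x :=
      (contDiffAt_const.inner ℝ contDiffAt_id).mul
        ((contDiffAt_norm ℝ hx').inv (norm_ne_zero_iff.mpr hx'))
    exact Complex.ofRealCLM.contDiff.contDiffAt.comp x
      ((show ContDiff ℝ ∞ (fun t => q.eval t) by
        simpa using q.contDiff_aeval (R := ℝ) (𝕜 := ℝ) ∞).contDiffAt.comp x h1)
  exact h.congr fun x hx => radialExt_zonalFun q ξ hx

theorem sphereLaplacian_zonalFun (q : Polynomial ℝ) (ξ η : Sph d) :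
    sphereLaplacian (zonalFun q ξ) η =
      (((1 - dot ξ η ^ 2) * q.derivative.derivative.eval (dot ξ η)
        - (d - 1) * dot ξ η * q.derivative.eval (dot ξ η) : ℝ) : ℂ) := by
  have hC : ContDiffAt ℝ 2 (radialExt (zonalFun q ξ)) η :=
    ((smoothOnSphere_zonalFun q ξ).contDiffAt
      (isOpen_compl_singleton.mem_nhds (sph_ne_zero η))).of_le (by norm_cast)
  let B := EuclideanSpace.basisFun (Fin d) ℝ
  have hη : ‖(η : EuclideanSpace ℝ (Fin d))‖ = 1 := norm_eq_of_mem_sphere η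
  have hξ : ‖(ξ : EuclideanSpace ℝ (Fin d))‖ = 1 := norm_eq_of_mem_sphere ξ
  have key (i : Fin d) : fderiv ℝ (fderiv ℝ (radialExt (zonalFun q ξ))) η (B i) (B i) =
      ((q.derivative.derivative.eval (dot ξ η) *
        (inner ℝ (ξ : EuclideanSpace ℝ (Fin d)) (B i) -
          dot ξ η * inner ℝ (B i) (η : EuclideanSpace ℝ (Fin d))) ^ 2
      + q.derivative.eval (dot ξ η) * (-2 * (inner ℝ (ξ : EuclideanSpace ℝ (Fin d)) (B i) *
          inner ℝ (B i) (η : EuclideanSpace ℝ (Fin d))) - dot ξ η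
        + 3 * dot ξ η * inner ℝ (B i) (η : EuclideanSpace ℝ (Fin d)) ^ 2) : ℝ) : ℂ) := by
    rw [fderiv_fderiv_eq_deriv_deriv hC, ← deriv_deriv_eval_normalized_line]
    have hl : Tendsto (fun s : ℝ => (η : EuclideanSpace ℝ (Fin d)) + s • B i) (𝓝 0) (𝓝 η) := by
      have : ContinuousAt (fun s : ℝ => (η : EuclideanSpace ℝ (Fin d)) + s • B i) 0 := by fun_prop
      simpa [ContinuousAt] using this
    have he : (fun s : ℝ => radialExt (zonalFun q ξ) ((η : EuclideanSpace ℝ (Fin d)) + s • B i))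
        =ᶠ[𝓝 0] fun s => ((q.eval ((dot ξ η + s * inner ℝ (ξ : EuclideanSpace ℝ (Fin d)) (B i)) *
          (1 + 2 * inner ℝ (B i) (η : EuclideanSpace ℝ (Fin d)) * s + s ^ 2)
            ^ (-(1 / 2) : ℝ)) : ℝ) : ℂ) := by
      filter_upwards [hl.eventually (isOpen_compl_singleton.mem_nhds (sph_ne_zero η))] with s hs
      rw [radialExt_zonalFun q ξ hs, inner_add_right, inner_smul_right]
      have hn : ‖(η : EuclideanSpace ℝ (Fin d)) + s • B i‖ ^ 2 =
          1 + 2 * inner ℝ (B i) (η : EuclideanSpace ℝ (Fin d)) * s + s ^ 2 := by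
        rw [norm_add_sq_real, hη, norm_smul, B.norm_eq_one, inner_smul_right,
          real_inner_comm, mul_one, Real.norm_eq_abs, sq_abs]
        ring
      rw [← hn, ← Real.rpow_natCast, ← Real.rpow_mul (norm_nonneg _)]
      norm_num [Real.rpow_neg_one, dot]
    exact (he.deriv).deriv_eq
  have s1 : ∑ i, inner ℝ (ξ : EuclideanSpace ℝ (Fin d)) (B i) ^ 2 = 1 := by
    rw [B.sum_sq_inner_left, hξ, one_pow]
  have s2 : ∑ i, inner ℝ (B i) (η : EuclideanSpace ℝ (Fin d)) ^ 2 = 1 := by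
    rw [B.sum_sq_inner_right, hη, one_pow]
  have s3 : ∑ i, inner ℝ (ξ : EuclideanSpace ℝ (Fin d)) (B i) *
      inner ℝ (B i) (η : EuclideanSpace ℝ (Fin d)) = dot ξ η := B.sum_inner_mul_inner _ _
  rw [sphereLaplacian, laplacian_eq_sum_fderiv B]
  simp only [key]
  rw [← Complex.ofReal_sum]
  congr 1
  have e (Q₂ Q₁ t A c : ℝ) : Q₂ * (A - t * c) ^ 2 + Q₁ * (-2 * (A * c) - t + 3 * t * c ^ 2)
      = Q₂ * A ^ 2 + (-2 * t * Q₂ - 2 * Q₁) * (A * c) + (Q₂ * t ^ 2 + 3 * t * Q₁) * c ^ 2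
        - Q₁ * t := by
    ring
  simp only [e, Finset.sum_sub_distrib, Finset.sum_add_distrib, ← Finset.mul_sum, s1, s2, s3]
  simp only [Finset.sum_const, Finset.card_univ, Fintype.card_fin, nsmul_eq_mul]
  ring

end Zonal

/-! ### Integrals of zonal polynomials -/

section Integrals

variable {d : ℕ}

theorem continuous_dot_right (ξ : Sph d) : Continuous fun η : Sph d => dot ξ η := by
  unfold dot
  fun_prop

theorem dot_self (ξ : Sph d) : dot ξ ξ = 1 := by
  rw [dot, real_inner_self_eq_norm_sq, norm_eq_of_mem_sphere ξ, one_pow]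

theorem dot_neg_self (ξ : Sph d) : dot ξ (-ξ) = -1 := by
  simp [dot]

theorem abs_dot_le_one (ξ η : Sph d) : |dot ξ η| ≤ 1 := by
  have := abs_real_inner_le_norm (ξ : EuclideanSpace ℝ (Fin d)) η
  rwa [norm_eq_of_mem_sphere ξ, norm_eq_of_mem_sphere η, one_mul] at this

theorem dist_sq_eq (ξ η : Sph d) : dist ξ η ^ 2 = 2 - 2 * dot ξ η := by
  rw [Subtype.dist_eq, dist_eq_norm, norm_sub_sq_real, norm_eq_of_mem_sphere ξ,
    norm_eq_of_mem_sphere η, dot]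
  ring

theorem dot_lt_one_of_ne {ξ η : Sph d} (h : η ≠ ξ) : dot ξ η < 1 := by
  have := dist_sq_eq ξ η
  have := pow_pos (dist_pos.mpr h.symm) 2
  linarith

theorem abs_dot_lt_one_of_ne {ξ η : Sph d} (h : η ≠ ξ) (h' : η ≠ -ξ) : |dot ξ η| < 1 := by
  rw [abs_lt]
  refine ⟨?_, dot_lt_one_of_ne h⟩
  have := dot_lt_one_of_ne h'
  have e : dot (-ξ) η = -dot ξ η := by simp [dot]
  linarith

theorem integrable_of_continuous_sphere {F : Type*} [NormedAddCommGroup F] {f : Sph d → F}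
    (hf : Continuous f) : Integrable f (surf d) :=
  hf.integrable_of_hasCompactSupport (HasCompactSupport.of_compactSpace f)

theorem surf_real_univ_pos (hd : 0 < d) : 0 < (surf d).real Set.univ := by
  have : Nonempty (Fin d) := ⟨⟨0, hd⟩⟩
  have : NeZero (surf d) := ⟨Measure.toSphere_ne_zero _⟩
  exact measureReal_univ_pos

/-- The integral over the sphere of a polynomial in `ξ · η`. -/
def zonalIntegral (ξ : Sph d) : Polynomial ℝ →ₗ[ℝ] ℝ where
  toFun p := ∫ η, p.eval (dot ξ η) ∂(surf d)
  map_add' p q := by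
    simp only [Polynomial.eval_add]
    exact integral_add (integrable_of_continuous_sphere
      (p.continuous.comp (continuous_dot_right ξ)))
      (integrable_of_continuous_sphere (q.continuous.comp (continuous_dot_right ξ)))
  map_smul' c p := by
    simp only [Polynomial.eval_smul, smul_eq_mul, RingHom.id_apply]
    exact integral_const_mul _ _

theorem zonalIntegral_apply (ξ : Sph d) (p : Polynomial ℝ) :
    zonalIntegral ξ p = ∫ η, p.eval (dot ξ η) ∂(surf d) := rfl

/-- The eigenvalue of `-Δ` on spherical harmonics of degree `k`. -/
def sphereEigenvalue (d k : ℕ) : ℝ := k * (k + d - 2)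

theorem sphereEigenvalue_injective (hd : 3 ≤ d) : Function.Injective (sphereEigenvalue d) := by
  have h3 : (3 : ℝ) ≤ d := by exact_mod_cast hd
  refine StrictMono.injective (strictMono_nat_of_lt_succ fun k => ?_)
  have : (0 : ℝ) ≤ k := k.cast_nonneg
  simp only [sphereEigenvalue]
  push_cast
  nlinarith

theorem sphereLaplacian_zonalPoly (k : ℕ) (ξ η : Sph d) :
    sphereLaplacian (zonalFun (zonalPoly d k) ξ) η =
      -(sphereEigenvalue d k : ℂ) * zonalFun (zonalPoly d k) ξ η := by
  rw [sphereLaplacian_zonalFun, zonalPoly_ode, zonalFun, sphereEigenvalue]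
  push_cast
  ring

theorem zonalIntegral_mul_of_ne (hd : 3 ≤ d) (ξ : Sph d) {j k : ℕ} (h : j ≠ k) :
    zonalIntegral ξ (zonalPoly d j * zonalPoly d k) = 0 := by
  have := integral_mul_eq_zero_of_eigenfunctions (by omega : 0 < d)
    (smoothOnSphere_zonalFun (zonalPoly d j) ξ) (smoothOnSphere_zonalFun (zonalPoly d k) ξ)
    ((sphereEigenvalue_injective hd).ne h) (sphereLaplacian_zonalPoly j ξ)
    (sphereLaplacian_zonalPoly k ξ)
  simp only [zonalFun, ← Complex.ofReal_mul, integral_complex_ofReal] at this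
  simp only [zonalIntegral_apply, Polynomial.eval_mul]
  exact_mod_cast this

theorem X_mul_zonalPoly_zero (hd : 3 ≤ d) :
    Polynomial.X * zonalPoly d 0 = zonalUp d 0 • zonalPoly d 1 := by
  refine Polynomial.funext fun t => ?_
  simpa using mul_zonalPoly_zero hd t

theorem X_mul_zonalPoly_succ (hd : 3 ≤ d) (k : ℕ) :
    Polynomial.X * zonalPoly d (k + 1) =
      zonalUp d (k + 1) • zonalPoly d (k + 2) + zonalDown d k • zonalPoly d k := by
  refine Polynomial.funext fun t => ?_
  simpa using mul_zonalPoly_succ hd k t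

theorem zonalIntegral_mul_self (hd : 3 ≤ d) (ξ : Sph d) (k : ℕ) :
    zonalIntegral ξ (zonalPoly d k * zonalPoly d k) =
      (surf d).real Set.univ * harmDim d k := by
  induction k with
  | zero => simp [zonalPoly_zero hd, harmDim_zero hd, zonalIntegral_apply]
  | succ k ih =>
    have h2 : zonalIntegral ξ (Polynomial.X * zonalPoly d k * zonalPoly d (k + 1)) =
        zonalDown d k * zonalIntegral ξ (zonalPoly d k * zonalPoly d k) := by
      rw [show Polynomial.X * zonalPoly d k * zonalPoly d (k + 1) =
        zonalPoly d k * (Polynomial.X * zonalPoly d (k + 1)) by ring, X_mul_zonalPoly_succ hd,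
        mul_add, map_add, mul_smul_comm, mul_smul_comm, map_smul, map_smul,
        zonalIntegral_mul_of_ne hd ξ (by omega : k ≠ k + 2)]
      simp
    have h1 : zonalIntegral ξ (Polynomial.X * zonalPoly d k * zonalPoly d (k + 1)) =
        zonalUp d k * zonalIntegral ξ (zonalPoly d (k + 1) * zonalPoly d (k + 1)) := by
      rcases k with _ | k
      · rw [X_mul_zonalPoly_zero hd, smul_mul_assoc, map_smul, smul_eq_mul]
      · rw [X_mul_zonalPoly_succ hd, add_mul, map_add, smul_mul_assoc, smul_mul_assoc, map_smul,
          map_smul, zonalIntegral_mul_of_ne hd ξ (by omega : k ≠ k + 1 + 1)]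
        simp
    apply mul_left_cancel₀ (zonalUp_pos hd k).ne'
    rw [← h1, h2, ih]
    linear_combination -(surf d).real Set.univ * harmDim_succ hd k

/-- The average of `(ξ · η)²` against the normalized density of the zonal harmonic of degree
`k`. -/
def zonalMoment (d : ℕ) : ℕ → ℝ
  | 0 => zonalUp d 0 * zonalDown d 0
  | k + 1 => zonalUp d (k + 1) * zonalDown d (k + 1) + zonalUp d k * zonalDown d k

theorem zonalIntegral_sq_mul_self (hd : 3 ≤ d) (ξ : Sph d) (k : ℕ) :
    zonalIntegral ξ (Polynomial.X ^ 2 * (zonalPoly d k * zonalPoly d k)) =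
      (surf d).real Set.univ * harmDim d k * zonalMoment d k := by
  rw [show Polynomial.X ^ 2 * (zonalPoly d k * zonalPoly d k) =
    (Polynomial.X * zonalPoly d k) * (Polynomial.X * zonalPoly d k) by ring]
  rcases k with _ | k
  · rw [X_mul_zonalPoly_zero hd, smul_mul_smul_comm, map_smul, zonalIntegral_mul_self hd,
      zonalMoment, smul_eq_mul]
    linear_combination (surf d).real Set.univ * zonalUp d 0 * harmDim_succ hd 0
  · rw [X_mul_zonalPoly_succ hd, add_mul, mul_add, mul_add]
    simp only [smul_mul_smul_comm, map_add, map_smul, zonalIntegral_mul_self hd,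
      zonalIntegral_mul_of_ne hd ξ (by omega : k ≠ k + 2),
      zonalIntegral_mul_of_ne hd ξ (by omega : k + 2 ≠ k), zonalMoment, smul_eq_mul]
    linear_combination
      (surf d).real Set.univ * zonalUp d (k + 1) * harmDim_succ hd (k + 1)
        - (surf d).real Set.univ * zonalDown d k * harmDim_succ hd k

theorem zonalUp_mul_zonalDown_ge (hd : 3 ≤ d) (k : ℕ) :
    3 / (4 * d) ≤ zonalUp d k * zonalDown d k := by
  have h3 : (3 : ℝ) ≤ d := by exact_mod_cast hd
  have hk : (0 : ℝ) ≤ k := k.cast_nonneg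
  have h1 : 0 < (2 * k + d : ℝ) := by linarith
  have h2 : 0 < (2 * k + d - 2 : ℝ) := by linarith
  rw [zonalUp, zonalDown, div_mul_div_comm, div_le_div_iff₀ (by positivity) (by positivity)]
  nlinarith [mul_nonneg hk (sub_nonneg.mpr h3), mul_nonneg (mul_nonneg hk hk) (sub_nonneg.mpr h3),
    mul_nonneg (mul_nonneg hk (sub_nonneg.mpr h3)) (sub_nonneg.mpr h3)]

theorem zonalMoment_zero (hd : 3 ≤ d) : zonalMoment d 0 = 1 / d := by
  have h3 : (3 : ℝ) ≤ d := by exact_mod_cast hd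
  have h2 : (d - 2 : ℝ) ≠ 0 := by intro h; linarith
  simp [zonalMoment, zonalUp, zonalDown, div_self h2]

theorem zonalMoment_succ_ge (hd : 3 ≤ d) (k : ℕ) : 3 / (2 * d) ≤ zonalMoment d (k + 1) := by
  have h1 := zonalUp_mul_zonalDown_ge hd k
  have h2 := zonalUp_mul_zonalDown_ge hd (k + 1)
  have : (3 / (2 * d) : ℝ) = 3 / (4 * d) + 3 / (4 * d) := by
    have : (d : ℝ) ≠ 0 := by exact_mod_cast (by omega : d ≠ 0)
    field_simp
    norm_num
  rw [zonalMoment, this]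
  linarith

theorem average_dot_sq (hd : 3 ≤ d) (ξ : Sph d) : ⨍ η, dot ξ η ^ 2 ∂(surf d) = 1 / d := by
  have h := zonalIntegral_sq_mul_self hd ξ 0
  rw [zonalMoment_zero hd, harmDim_zero hd, zonalPoly_zero hd] at h
  simp only [zonalIntegral_apply, mul_one, Polynomial.eval_pow, Polynomial.eval_X] at h
  have := (surf_real_univ_pos (by omega : 0 < d)).ne'
  rw [average_eq, h, smul_eq_mul]
  field_simp

/-! ### Growth of the dimensions and boundedness of zonal polynomials -/

theorem harmDim_ge (hd : 3 ≤ d) (k : ℕ) : (2 * k + d - 2) / (d - 2) ≤ harmDim d k := by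
  have h3 : (3 : ℝ) ≤ d := by exact_mod_cast hd
  have hd2 : (0 : ℝ) < d - 2 := by linarith
  induction k with
  | zero =>
    rw [harmDim_zero hd]
    push_cast
    rw [div_le_one hd2]
    linarith
  | succ k ih =>
    have hk : (0 : ℝ) ≤ k := k.cast_nonneg
    have h2 : 0 < (2 * k + d - 2 : ℝ) := by linarith
    have h1 : 0 < (2 * k + d : ℝ) := by linarith
    have h := harmDim_succ hd k
    rw [zonalUp, zonalDown] at h
    rw [div_le_iff₀ hd2] at ih ⊢
    push_cast
    have hk1 : (0 : ℝ) < k + 1 := by linarith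
    have h' : (k + 1) * harmDim d (k + 1) * (2 * k + d - 2)
        = (k + d - 2) * harmDim d k * (2 * k + d) := by
      rw [div_mul_eq_mul_div, div_mul_eq_mul_div, div_eq_div_iff h1.ne' h2.ne'] at h
      linear_combination h
    have hN := harmDim_pos hd k
    have : (k + 1) * (2 * k + d - 2) * (2 * k + d)
        ≤ (k + 1) * (2 * k + d - 2) * (harmDim d (k + 1) * (d - 2)) := by
      calc _ ≤ (k + 1) * (harmDim d k * (d - 2)) * (2 * k + d) := by gcongr
        _ ≤ (k + d - 2) * (harmDim d k * (d - 2)) * (2 * k + d) := by gcongr; linarith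
        _ = _ := by linear_combination -(d - 2) * h'
    have := le_of_mul_le_mul_left this (by positivity)
    linarith

theorem one_le_harmDim (hd : 3 ≤ d) (k : ℕ) : 1 ≤ harmDim d k := by
  refine le_trans ?_ (harmDim_ge hd k)
  have h3 : (3 : ℝ) ≤ d := by exact_mod_cast hd
  have hk : (0 : ℝ) ≤ k := k.cast_nonneg
  rw [le_div_iff₀ (by linarith)]
  linarith

theorem tendsto_harmDim (hd : 3 ≤ d) : Tendsto (harmDim d) atTop atTop := by
  have h3 : (3 : ℝ) ≤ d := by exact_mod_cast hd
  refine tendsto_atTop_mono (harmDim_ge hd) (Tendsto.atTop_div_const (by linarith) ?_)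
  refine tendsto_atTop_mono (fun k => ?_) tendsto_natCast_atTop_atTop
  have hk : (0 : ℝ) ≤ k := k.cast_nonneg
  linarith

end Integrals

section Bound

variable {d : ℕ}

/-- A quadratic form in consecutive normalized zonal polynomials that is almost conserved. -/
def zonalEnergy (d : ℕ) (t : ℝ) (k : ℕ) : ℝ :=
  zonalUp d k * zonalDown d k * ((zonalPoly d (k + 1)).eval t ^ 2 / harmDim d (k + 1)
      + (zonalPoly d k).eval t ^ 2 / harmDim d k)
    - t * (zonalUp d k * (zonalPoly d (k + 1)).eval t * (zonalPoly d k).eval t / harmDim d k)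

theorem zonalEnergy_succ (hd : 3 ≤ d) (t : ℝ) (k : ℕ) :
    zonalEnergy d t (k + 1) = zonalEnergy d t k +
      (zonalUp d (k + 1) * zonalDown d (k + 1) - zonalUp d k * zonalDown d k) *
        ((zonalPoly d (k + 1)).eval t ^ 2 / harmDim d (k + 1)) := by
  have hN := (harmDim_pos hd k).ne'
  have hN1 := (harmDim_pos hd (k + 1)).ne'
  have hN2 := (harmDim_pos hd (k + 2)).ne'
  have hu := (zonalUp_pos hd k).ne'
  have hu1 := (zonalUp_pos hd (k + 1)).ne'
  have hl := (zonalDown_pos hd k).ne'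
  have hl1 := (zonalDown_pos hd (k + 1)).ne'
  have hr := mul_zonalPoly_succ hd k t
  have e1 : zonalDown d (k + 1) / harmDim d (k + 2) = zonalUp d (k + 1) / harmDim d (k + 1) := by
    rw [div_eq_div_iff hN2 hN1, ← harmDim_succ hd (k + 1)]
  have e0 : zonalUp d k / harmDim d k = zonalDown d k / harmDim d (k + 1) := by
    rw [div_eq_div_iff hN hN1, ← harmDim_succ hd k]
  simp only [zonalEnergy]
  set x := (zonalPoly d k).eval t
  set y := (zonalPoly d (k + 1)).eval t
  set z := (zonalPoly d (k + 2)).eval t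
  linear_combination zonalUp d (k + 1) * z ^ 2 * e1
    - (zonalDown d k * x ^ 2 - t * y * x) * e0
    - (zonalUp d (k + 1) * z - zonalDown d k * x) / harmDim d (k + 1) * hr

theorem abs_zonalUp_mul_zonalDown_sub_le (hd : 3 ≤ d) (k : ℕ) :
    |zonalUp d k * zonalDown d k - 1 / 4| ≤ (d : ℝ) ^ 2 / (k + 1) ^ 2 := by
  have h3 : (3 : ℝ) ≤ d := by exact_mod_cast hd
  have hk : (0 : ℝ) ≤ k := k.cast_nonneg
  have h2 : 0 < (2 * k + d - 2 : ℝ) := by linarith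
  have h1 : 0 < (2 * k + d : ℝ) := by linarith
  have e : zonalUp d k * zonalDown d k - 1 / 4 =
      (d - 2) * (4 - d) / (4 * ((2 * k + d) * (2 * k + d - 2))) := by
    rw [zonalUp, zonalDown, div_mul_div_comm, div_sub_div _ _ (by positivity) (by norm_num),
      div_eq_div_iff (by positivity) (by positivity)]
    ring
  rw [e, abs_div, abs_of_pos (by positivity : (0 : ℝ) < 4 * ((2 * k + d) * (2 * k + d - 2)))]
  gcongr ?_ / ?_
  · rw [abs_le]
    constructor <;> nlinarith
  · nlinarith

theorem tendsto_zonalUp_mul_zonalDown (hd : 3 ≤ d) :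
    Tendsto (fun k => zonalUp d k * zonalDown d k) atTop (𝓝 (1 / 4)) := by
  rw [tendsto_iff_norm_sub_tendsto_zero]
  refine squeeze_zero (fun _ => norm_nonneg _) (abs_zonalUp_mul_zonalDown_sub_le hd) ?_
  refine tendsto_const_nhds.div_atTop ?_
  exact (tendsto_pow_atTop two_ne_zero).comp
    (tendsto_atTop_add_const_right _ _ tendsto_natCast_atTop_atTop)

theorem zonalEnergy_ge (hd : 3 ≤ d) {t s : ℝ} (hs : |t| ≤ s) {k : ℕ}
    (hk : s ^ 2 / 4 ≤ zonalUp d k * zonalDown d k) :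
    s / 2 * ((s - |t|) / 2) * ((zonalPoly d (k + 1)).eval t ^ 2 / harmDim d (k + 1)
      + (zonalPoly d k).eval t ^ 2 / harmDim d k) ≤ zonalEnergy d t k := by
  have hN := harmDim_pos hd k
  have hN1 := harmDim_pos hd (k + 1)
  have hs0 : 0 ≤ s := (abs_nonneg t).trans hs
  set A := (zonalPoly d (k + 1)).eval t ^ 2 / harmDim d (k + 1) with hA
  set B := (zonalPoly d k).eval t ^ 2 / harmDim d k with hB
  set X := zonalUp d k * (zonalPoly d (k + 1)).eval t * (zonalPoly d k).eval t / harmDim d k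
    with hX
  have hA0 : 0 ≤ A := by positivity
  have hB0 : 0 ≤ B := by positivity
  have e0 : zonalUp d k / harmDim d k = zonalDown d k / harmDim d (k + 1) := by
    rw [div_eq_div_iff hN.ne' hN1.ne', ← harmDim_succ hd k]
  have hX2 : X ^ 2 = zonalUp d k * zonalDown d k * (A * B) := by
    rw [hX, hA, hB]
    linear_combination zonalUp d k / harmDim d k * ((zonalPoly d (k + 1)).eval t) ^ 2
      * (zonalPoly d k).eval t ^ 2 * e0
  have hE : zonalEnergy d t k = zonalUp d k * zonalDown d k * (A + B) - t * X := rfl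
  rw [hE]
  set β := zonalUp d k * zonalDown d k
  have hβ0 : 0 ≤ β := le_trans (by positivity) hk
  set α := √β with hα
  have hα2 : α ^ 2 = β := Real.sq_sqrt hβ0
  have hα0 : 0 ≤ α := Real.sqrt_nonneg _
  have hαs : s / 2 ≤ α := by
    apply Real.le_sqrt_of_sq_le
    linarith [show (s / 2) ^ 2 = s ^ 2 / 4 by ring]
  have hXle : |X| ≤ α * ((A + B) / 2) := by
    apply abs_le_of_sq_le_sq _ (by positivity)
    rw [hX2, mul_pow, hα2]
    gcongr
    nlinarith [sq_nonneg (A - B)]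
  have htX : t * X ≤ |t| * (α * ((A + B) / 2)) := by
    calc t * X ≤ |t * X| := le_abs_self _
      _ = |t| * |X| := abs_mul _ _
      _ ≤ _ := by gcongr
  have h1 : s / 2 * ((s - |t|) / 2) * (A + B) ≤ α * (α - |t| / 2) * (A + B) := by
    gcongr ?_ * (A + B)
    apply mul_le_mul hαs _ _ hα0 <;> linarith
  rw [← hα2]
  nlinarith

/-- Away from the poles, the zonal polynomials are of the order of the square root of the
dimension. -/
theorem exists_zonalPoly_sq_le (hd : 3 ≤ d) {t : ℝ} (ht : |t| < 1) :
    ∃ C : ℝ, ∀ k, (zonalPoly d k).eval t ^ 2 ≤ C * harmDim d k := by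
  set s := (1 + |t|) / 2 with hs
  have hts : |t| < s := by rw [hs]; linarith
  have hs0 : 0 < s := (abs_nonneg t).trans_lt hts
  have hs1 : s < 1 := by rw [hs]; linarith
  set c := s / 2 * ((s - |t|) / 2) with hc
  have hc0 : 0 < c := mul_pos (by linarith) (by linarith)
  set A : ℕ → ℝ := fun k => (zonalPoly d k).eval t ^ 2 / harmDim d k with hA
  have hA0 (k) : 0 ≤ A k := div_nonneg (sq_nonneg _) (harmDim_pos hd k).le
  obtain ⟨K, hK⟩ := eventually_atTop.mp ((tendsto_zonalUp_mul_zonalDown hd).eventually_const_le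
    (show s ^ 2 / 4 < 1 / 4 by nlinarith))
  have hG (k) (hk : K ≤ k) : c * (A (k + 1) + A k) ≤ zonalEnergy d t k :=
    zonalEnergy_ge hd hts.le (hK k hk)
  have hG1 (k) (hk : K ≤ k) : c * A (k + 1) ≤ zonalEnergy d t k :=
    le_trans (by nlinarith [hA0 k]) (hG k hk)
  set D : ℕ → ℝ := fun k => 2 * (d : ℝ) ^ 2 / c * (1 / (k + 1 : ℝ) ^ 2) with hD
  have hD0 (k) : 0 ≤ D k := by positivity
  have hDs : Summable D := by
    refine Summable.mul_left _ ?_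
    have := (summable_nat_add_iff 1).mpr (Real.summable_one_div_nat_pow.mpr one_lt_two)
    simpa using this
  have hstep (k) (hk : K ≤ k) :
      zonalEnergy d t (k + 1) ≤ zonalEnergy d t k * Real.exp (D k) := by
    have hG0 : 0 ≤ zonalEnergy d t k := le_trans (mul_nonneg hc0.le (hA0 _)) (hG1 k hk)
    have hδ : zonalUp d (k + 1) * zonalDown d (k + 1) - zonalUp d k * zonalDown d k ≤ c * D k := by
      have h1 := (abs_le.mp (abs_zonalUp_mul_zonalDown_sub_le hd k)).1
      have h2 := (abs_le.mp (abs_zonalUp_mul_zonalDown_sub_le hd (k + 1))).2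
      have h3 : (d : ℝ) ^ 2 / ((k + 1 : ℕ) + 1) ^ 2 ≤ (d : ℝ) ^ 2 / (k + 1) ^ 2 := by
        push_cast
        gcongr
        linarith
      have h4 : c * D k = 2 * ((d : ℝ) ^ 2 / (k + 1) ^ 2) := by
        rw [hD]
        field_simp
      linarith
    rw [zonalEnergy_succ hd]
    calc _ ≤ zonalEnergy d t k + c * D k * A (k + 1) := by
          gcongr
          exact hA0 (k + 1)
      _ = zonalEnergy d t k + D k * (c * A (k + 1)) := by ring
      _ ≤ zonalEnergy d t k + D k * zonalEnergy d t k := by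
          gcongr
          exact hG1 k hk
      _ = zonalEnergy d t k * (D k + 1) := by ring
      _ ≤ _ := by
          gcongr
          exact Real.add_one_le_exp _
  have hGK : 0 ≤ zonalEnergy d t K := le_trans (mul_nonneg hc0.le (hA0 _)) (hG1 K le_rfl)
  have hbound (k) (hk : K ≤ k) :
      zonalEnergy d t k ≤ zonalEnergy d t K * Real.exp (∑ j ∈ Finset.range k, D j) := by
    induction k, hk using Nat.le_induction with
    | base =>
      exact le_mul_of_one_le_right hGK (Real.one_le_exp (Finset.sum_nonneg fun j _ => hD0 j))
    | succ k hk ih =>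
      rw [Finset.sum_range_succ, Real.exp_add, ← mul_assoc]
      exact (hstep k hk).trans (by gcongr)
  have hev : IsBoundedUnder (· ≤ ·) atTop A := by
    refine isBoundedUnder_of_eventually_le
      (a := zonalEnergy d t K * Real.exp (∑' j, D j) / c) ?_
    filter_upwards [eventually_ge_atTop (K + 1)] with k hk
    obtain ⟨k, rfl⟩ : ∃ j, k = j + 1 := ⟨k - 1, by omega⟩
    have hk' : K ≤ k := by omega
    rw [le_div_iff₀ hc0, mul_comm]
    refine (hG1 k hk').trans ((hbound k hk').trans ?_)
    gcongr
    exact hDs.sum_le_tsum _ fun j _ => hD0 j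
  obtain ⟨C, hC⟩ := hev.bddAbove_range
  refine ⟨C, fun k => ?_⟩
  have := hC ⟨k, rfl⟩
  rwa [hA, div_le_iff₀ (harmDim_pos hd k)] at this

end Bound

section Kernel

variable {d : ℕ}

/-! ### The weights -/

theorem weight_pos (d n k : ℕ) : 0 < weight d n k := by
  unfold weight
  positivity

theorem weight_zero (d n : ℕ) : weight d n 0 = 1 := by
  rw [weight, Nat.sub_zero, Nat.add_zero]
  exact div_self (by positivity)

theorem weight_succ (hd : 3 ≤ d) {n k : ℕ} (hk : k < n) :
    weight d n (k + 1) = weight d n k * ((n - k) / (n + k + d - 1)) := by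
  obtain ⟨m, rfl⟩ := Nat.exists_eq_add_of_le' hd
  obtain ⟨j, rfl⟩ : ∃ j, n = k + 1 + j := Nat.exists_eq_add_of_le hk
  simp only [weight, show k + 1 + j - (k + 1) = j by omega, show k + 1 + j - k = j + 1 by omega,
    show k + 1 + j + (k + 1) + (m + 3) - 2 = (k + 1 + j + k + m + 1) + 1 by omega,
    show k + 1 + j + k + (m + 3) - 2 = k + 1 + j + k + m + 1 by omega, Nat.factorial_succ]
  push_cast
  rw [show (k + 1 + j - k : ℝ) = j + 1 by ring,
    show (k + 1 + j + k + (m + 3) - 1 : ℝ) = k + 1 + j + k + m + 1 + 1 by ring]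
  field_simp

theorem weight_succ_left (hd : 3 ≤ d) {n k : ℕ} (hk : k ≤ n) :
    weight d (n + 1) k =
      weight d n k * ((n + 1) * (n + d - 1) / ((n + 1 - k) * (n + k + d - 1))) := by
  obtain ⟨m, rfl⟩ := Nat.exists_eq_add_of_le' hd
  obtain ⟨j, rfl⟩ := Nat.exists_eq_add_of_le hk
  simp only [weight, show k + j + 1 - k = j + 1 by omega, show k + j - k = j by omega,
    show k + j + 1 + k + (m + 3) - 2 = (k + j + k + m + 1) + 1 by omega,
    show k + j + k + (m + 3) - 2 = k + j + k + m + 1 by omega,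
    show k + j + 1 + (m + 3) - 2 = (k + j + m + 1) + 1 by omega,
    show k + j + (m + 3) - 2 = k + j + m + 1 by omega, Nat.factorial_succ]
  push_cast
  rw [show (k + j + 1 - k : ℝ) = j + 1 by ring,
    show (k + j + k + (m + 3) - 1 : ℝ) = k + j + k + m + 1 + 1 by ring,
    show (k + j + (m + 3) - 1 : ℝ) = k + j + m + 1 + 1 by ring]
  field_simp

theorem tendsto_weight (hd : 3 ≤ d) (k : ℕ) : Tendsto (fun n => weight d n k) atTop (𝓝 1) := by
  induction k with
  | zero => simp [weight_zero]
  | succ k ih =>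
    have h : Tendsto (fun n : ℕ => ((n - k) / (n + k + d - 1) : ℝ)) atTop (𝓝 1) := by
      have h0 : Tendsto (fun n : ℕ => (n + k + d - 1 : ℝ)) atTop atTop := by
        refine tendsto_atTop_mono (fun n => ?_) tendsto_natCast_atTop_atTop
        have h3 : (3 : ℝ) ≤ d := by exact_mod_cast hd
        have hk : (0 : ℝ) ≤ k := k.cast_nonneg
        linarith
      have h1 : Tendsto (fun n : ℕ => 1 - (2 * k + d - 1 : ℝ) / (n + k + d - 1)) atTop
          (𝓝 (1 - 0)) := tendsto_const_nhds.sub (tendsto_const_nhds.div_atTop h0)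
      rw [sub_zero] at h1
      refine h1.congr' ?_
      filter_upwards [h0.eventually_gt_atTop 0] with n hn
      rw [one_sub_div hn.ne']
      ring
    have := ih.mul h
    rw [one_mul] at this
    refine this.congr' ?_
    filter_upwards [eventually_gt_atTop k] with n hn
    exact (weight_succ hd hn).symm

/-! ### The explicit form of the kernel -/

/-- The normalizing constants of the powers `((1 + t) / 2)^n`. -/
def valleePoussinConst (d : ℕ) : ℕ → ℝ
  | 0 => 1
  | n + 1 => valleePoussinConst d n * ((2 * n + d - 1) / (2 * (n + d - 1)))

theorem valleePoussinConst_pos (hd : 3 ≤ d) (n : ℕ) : 0 < valleePoussinConst d n := by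
  have h3 : (3 : ℝ) ≤ d := by exact_mod_cast hd
  induction n with
  | zero => exact one_pos
  | succ n ih =>
    have hn : (0 : ℝ) ≤ n := n.cast_nonneg
    exact mul_pos ih (div_pos (by linarith) (by linarith))

theorem one_add_mul_sum_weight (hd : 3 ≤ d) (n : ℕ) (t : ℝ) {j : ℕ} (hj : j ≤ n) :
    (1 + t) * ∑ k ∈ Finset.range (j + 1), weight d n k * (zonalPoly d k).eval t =
      (2 * n + d - 1) / (n + d - 1) *
        ∑ k ∈ Finset.range (j + 1), weight d (n + 1) k * (zonalPoly d k).eval t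
      + weight d n j * (zonalUp d j * (zonalPoly d (j + 1)).eval t
        - (n - j) / (n + j + d - 1) * zonalDown d j * (zonalPoly d j).eval t) := by
  have h3 : (3 : ℝ) ≤ d := by exact_mod_cast hd
  have hn : (0 : ℝ) ≤ n := n.cast_nonneg
  have hnd : (0 : ℝ) < n + d - 1 := by linarith
  induction j with
  | zero =>
    have h0 := mul_zonalPoly_zero hd t
    have hl : zonalDown d 0 = 1 := by
      rw [zonalDown]
      push_cast
      rw [div_eq_one_iff_eq (by linarith)]
      ring
    simp only [zero_add, Finset.sum_range_one, weight_zero, hl]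
    rw [zonalPoly_zero hd] at h0 ⊢
    simp only [Polynomial.eval_one] at h0 ⊢
    push_cast
    have : (2 * n + d - 1) / (n + d - 1) - (n - 0) / (n + 0 + d - 1) = (1 : ℝ) := by
      rw [add_zero, ← sub_div, div_eq_one_iff_eq hnd.ne']
      ring
    linear_combination h0 - this
  | succ j ih =>
    have hj' : (j : ℝ) + 1 ≤ n := by exact_mod_cast hj
    have hj0 : (0 : ℝ) ≤ j := j.cast_nonneg
    have ih := ih (by omega)
    rw [Finset.sum_range_succ, mul_add, ih, Finset.sum_range_succ _ (j + 1), mul_add]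
    have hr := mul_zonalPoly_succ hd j t
    have hw : weight d n (j + 1) = weight d n j * ((n - j) / (n + j + d - 1)) := weight_succ hd hj
    have hw' := weight_succ_left hd hj
    have hA : (0 : ℝ) < n - j := by linarith
    have hB : (0 : ℝ) < n + j + d - 1 := by linarith
    have hC : (0 : ℝ) < n + j + d := by linarith
    have hD : (0 : ℝ) < 2 * j + d := by linarith
    have key : weight d n (j + 1) = (2 * n + d - 1) / (n + d - 1) * weight d (n + 1) (j + 1)
        - weight d n (j + 1) * ((n - (j + 1)) / (n + j + d)) * zonalDown d (j + 1)
        - weight d n j * zonalUp d j := by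
      rw [hw', hw, zonalDown, zonalUp]
      push_cast
      rw [show (n + 1 - (j + 1) : ℝ) = n - j by ring,
        show (n + (j + 1) + d - 1 : ℝ) = n + j + d by ring,
        show (2 * (j + 1) + d - 2 : ℝ) = 2 * j + d by ring]
      field_simp
      ring
    push_cast
    rw [show (n + (j + 1) + d - 1 : ℝ) = n + j + d by ring]
    linear_combination (zonalPoly d (j + 1)).eval t * key + weight d n (j + 1) * hr
      + zonalDown d j * (zonalPoly d j).eval t * hw

theorem sum_weight_mul_zonalPoly (hd : 3 ≤ d) (n : ℕ) (t : ℝ) :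
    ∑ k ∈ Finset.range (n + 1), weight d n k * (zonalPoly d k).eval t =
      ((1 + t) / 2) ^ n / valleePoussinConst d n := by
  have h3 : (3 : ℝ) ≤ d := by exact_mod_cast hd
  induction n with
  | zero => simp [weight_zero, zonalPoly_zero hd, valleePoussinConst]
  | succ n ih =>
    have hn : (0 : ℝ) ≤ n := n.cast_nonneg
    have hnd : (0 : ℝ) < n + d - 1 := by linarith
    have hr : (0 : ℝ) < 2 * n + d - 1 := by linarith
    have hlast : (2 * n + d - 1) / (n + d - 1) * weight d (n + 1) (n + 1)
        = weight d n n * zonalUp d n := by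
      have hD : (0 : ℝ) < 2 * n + d := by linarith
      rw [weight_succ hd (Nat.lt_succ_self n), weight_succ_left hd le_rfl, zonalUp]
      push_cast
      rw [show (n + 1 + n + d - 1 : ℝ) = 2 * n + d by ring,
        show (n + n + d - 1 : ℝ) = 2 * n + d - 1 by ring,
        show (n + 1 - n : ℝ) = 1 by ring]
      field_simp
    have h := one_add_mul_sum_weight hd n t le_rfl
    rw [ih, sub_self] at h
    have hv := (valleePoussinConst_pos hd n).ne'
    have e : (2 * n + d - 1) / (n + d - 1) *
        ∑ k ∈ Finset.range (n + 1 + 1), weight d (n + 1) k * (zonalPoly d k).eval t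
        = (1 + t) * (((1 + t) / 2) ^ n / valleePoussinConst d n) := by
      rw [Finset.sum_range_succ, mul_add]
      linear_combination -h + (zonalPoly d (n + 1)).eval t * hlast
    rw [valleePoussinConst]
    field_simp at e ⊢
    rw [e, pow_succ]
    ring

theorem diracKernel_eq (hd : 3 ≤ d) (n : ℕ) (ξ η : Sph d) :
    diracKernel d n ξ η =
      ((1 + dot ξ η) / 2) ^ n / (valleePoussinConst d n * (surf d).real Set.univ) := by
  rw [diracKernel, ← div_div, ← sum_weight_mul_zonalPoly hd, Finset.sum_div]
  refine Finset.sum_congr rfl fun k _ => ?_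
  rw [zonal_eq hd, mul_div_assoc]

theorem continuous_zonal (hd : 3 ≤ d) (k : ℕ) (ξ : Sph d) : Continuous (zonal d k ξ) := by
  have : zonal d k ξ = fun η => (zonalPoly d k).eval (dot ξ η) / (surf d).real Set.univ :=
    funext fun η => zonal_eq hd k ξ η
  rw [this]
  exact ((zonalPoly d k).continuous.comp (continuous_dot_right ξ)).div_const _

theorem integral_zonal_mul_zonal (hd : 3 ≤ d) (ξ : Sph d) (j k : ℕ) :
    ∫ η, zonal d j ξ η * zonal d k ξ η ∂(surf d) =
      if j = k then harmDim d k / (surf d).real Set.univ else 0 := by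
  have hS := (surf_real_univ_pos (by omega : 0 < d)).ne'
  have e : ∀ η, zonal d j ξ η * zonal d k ξ η =
      ((surf d).real Set.univ ^ 2)⁻¹ * (zonalPoly d j * zonalPoly d k).eval (dot ξ η) := by
    intro η
    rw [zonal_eq hd, zonal_eq hd, Polynomial.eval_mul]
    field_simp
  simp only [e]
  rw [integral_const_mul, ← zonalIntegral_apply]
  split_ifs with h
  · rw [h, zonalIntegral_mul_self hd]
    field_simp
  · rw [zonalIntegral_mul_of_ne hd ξ h, mul_zero]

theorem integral_dot_sq_mul_zonal_sq (hd : 3 ≤ d) (ξ : Sph d) (k : ℕ) :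
    ∫ η, dot ξ η ^ 2 * zonal d k ξ η ^ 2 ∂(surf d) =
      harmDim d k / (surf d).real Set.univ * zonalMoment d k := by
  have hS := (surf_real_univ_pos (by omega : 0 < d)).ne'
  have e : ∀ η, dot ξ η ^ 2 * zonal d k ξ η ^ 2 = ((surf d).real Set.univ ^ 2)⁻¹ *
      (Polynomial.X ^ 2 * (zonalPoly d k * zonalPoly d k)).eval (dot ξ η) := by
    intro η
    rw [zonal_eq hd, Polynomial.eval_mul, Polynomial.eval_mul, Polynomial.eval_pow,
      Polynomial.eval_X]
    field_simp
  simp only [e]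
  rw [integral_const_mul, ← zonalIntegral_apply, zonalIntegral_sq_mul_self hd]
  field_simp

theorem zonal_zero (hd : 3 ≤ d) (ξ η : Sph d) : zonal d 0 ξ η = 1 / (surf d).real Set.univ := by
  rw [zonal_eq hd, zonalPoly_zero hd, Polynomial.eval_one]

theorem continuous_diracKernel (hd : 3 ≤ d) (n : ℕ) (ξ : Sph d) :
    Continuous (diracKernel d n ξ) := by
  unfold diracKernel
  exact continuous_finsetSum _ fun k _ => (continuous_zonal hd k ξ).const_mul _

theorem integral_diracKernel (hd : 3 ≤ d) (n : ℕ) (ξ : Sph d) :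
    ∫ η, diracKernel d n ξ η ∂(surf d) = 1 := by
  have hS := (surf_real_univ_pos (by omega : 0 < d)).ne'
  have hz (k : ℕ) : ∫ η, zonal d k ξ η ∂(surf d) = if k = 0 then 1 else 0 := by
    have h := integral_zonal_mul_zonal hd ξ k 0
    simp only [zonal_zero hd, integral_mul_const, harmDim_zero hd] at h
    split_ifs at h ⊢ with hk
    · field_simp at h
      exact h
    · exact (mul_eq_zero.mp h).resolve_right (one_div_ne_zero hS)
  unfold diracKernel
  rw [integral_finsetSum _ fun k _ =>
    (integrable_of_continuous_sphere (continuous_zonal hd k ξ)).const_mul _]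
  simp only [integral_const_mul, hz]
  simp [weight_zero]

theorem one_add_dot_div_two_nonneg (ξ η : Sph d) : 0 ≤ (1 + dot ξ η) / 2 := by
  have := (abs_le.mp (abs_dot_le_one ξ η)).1
  linarith

theorem tendsto_pow_div_valleePoussinConst (hd : 3 ≤ d) {q : ℝ} (hq0 : 0 < q) (hq : q < 1) :
    Tendsto (fun n => q ^ n / valleePoussinConst d n) atTop (𝓝 0) := by
  have h3 : (3 : ℝ) ≤ d := by exact_mod_cast hd
  have hpos (n : ℕ) : 0 < q ^ n / valleePoussinConst d n :=
    div_pos (pow_pos hq0 n) (valleePoussinConst_pos hd n)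
  refine (summable_of_ratio_test_tendsto_lt_one hq (.of_forall fun n => (hpos n).ne')
    ?_).tendsto_atTop_zero
  have h0 : Tendsto (fun n : ℕ => (2 * n + d - 1 : ℝ)) atTop atTop := by
    refine tendsto_atTop_mono (fun n => ?_) tendsto_natCast_atTop_atTop
    have hn : (0 : ℝ) ≤ n := n.cast_nonneg
    linarith
  have h1 : Tendsto (fun n : ℕ => q * (1 + (d - 1 : ℝ) / (2 * n + d - 1))) atTop
      (𝓝 (q * (1 + 0))) :=
    (tendsto_const_nhds.add (tendsto_const_nhds.div_atTop h0)).const_mul q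
  rw [add_zero, mul_one] at h1
  refine h1.congr fun n => ?_
  have hn : (0 : ℝ) ≤ n := n.cast_nonneg
  have hv := (valleePoussinConst_pos hd n).ne'
  have e1 : (0 : ℝ) < 2 * n + d - 1 := by linarith
  have e2 : (0 : ℝ) < n + d - 1 := by linarith
  rw [Real.norm_of_nonneg (hpos _).le, Real.norm_of_nonneg (hpos _).le, valleePoussinConst]
  field_simp
  ring

/-- The kernels are approximate identities. -/
theorem tendstoUniformly_integral_diracKernel (hd : 3 ≤ d) (f : C(Sph d, ℂ)) :
    TendstoUniformly
      (fun (n : ℕ) (ζ : Sph d) => ∫ η, (diracKernel d n ζ η : ℂ) * f η ∂(surf d)) f atTop := by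
  have hS := surf_real_univ_pos (by omega : 0 < d)
  rw [Metric.tendstoUniformly_iff]
  intro ε hε
  obtain ⟨δ₀, hδ₀, hf⟩ := Metric.uniformContinuous_iff.mp
    (CompactSpace.uniformContinuous_of_continuous f.continuous) (ε / 2) (half_pos hε)
  set δ := min δ₀ 1 with hδ
  have hδ0 : 0 < δ := lt_min hδ₀ one_pos
  have hδ1 : δ ≤ 1 := min_le_right _ _
  set q := 1 - δ ^ 2 / 4 with hq
  have hq1 : q < 1 := by rw [hq]; nlinarith [pow_pos hδ0 2]
  have hq0 : 0 < q := by rw [hq]; nlinarith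
  have hlim : Tendsto (fun n => 2 * ‖f‖ * (q ^ n / valleePoussinConst d n)) atTop (𝓝 0) := by
    simpa using (tendsto_pow_div_valleePoussinConst hd hq0 hq1).const_mul (2 * ‖f‖)
  filter_upwards [hlim.eventually_lt_const (half_pos hε)] with n hn ζ
  have hv := valleePoussinConst_pos hd n
  have hcR := continuous_diracKernel hd n ζ
  have hR0 (η) : 0 ≤ diracKernel d n ζ η := by
    rw [diracKernel_eq hd]
    have := one_add_dot_div_two_nonneg ζ η
    positivity
  have hcRc : Continuous fun η => (diracKernel d n ζ η : ℂ) :=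
    Complex.continuous_ofReal.comp hcR
  have e1 : (∫ η, (diracKernel d n ζ η : ℂ) * f η ∂(surf d)) - f ζ =
      ∫ η, (diracKernel d n ζ η : ℂ) * (f η - f ζ) ∂(surf d) := by
    simp only [mul_sub]
    have i1 : Integrable (fun η => (diracKernel d n ζ η : ℂ) * f η) (surf d) :=
      integrable_of_continuous_sphere (hcRc.mul f.continuous)
    have i2 : Integrable (fun η => (diracKernel d n ζ η : ℂ) * f ζ) (surf d) :=
      integrable_of_continuous_sphere (hcRc.mul continuous_const)
    rw [integral_sub i1 i2, integral_mul_const,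
      integral_complex_ofReal, integral_diracKernel hd]
    simp
  set b : ℝ := 2 * ‖f‖ * (q ^ n / (valleePoussinConst d n * (surf d).real Set.univ)) with hb
  have hb0 : 0 ≤ b := by positivity
  have hpt (η) : ‖(diracKernel d n ζ η : ℂ) * (f η - f ζ)‖ ≤ ε / 2 * diracKernel d n ζ η + b := by
    rw [norm_mul, Complex.norm_real, Real.norm_of_nonneg (hR0 η)]
    by_cases hdist : dist η ζ < δ
    · have h := (hf (hdist.trans_le (min_le_left _ _))).le
      rw [dist_eq_norm] at h
      nlinarith [mul_le_mul_of_nonneg_left h (hR0 η)]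
    · rw [not_lt] at hdist
      have h1 : ‖f η - f ζ‖ ≤ 2 * ‖f‖ := by
        calc _ ≤ ‖f η‖ + ‖f ζ‖ := norm_sub_le _ _
          _ ≤ ‖f‖ + ‖f‖ := add_le_add (f.norm_coe_le_norm η) (f.norm_coe_le_norm ζ)
          _ = _ := by ring
      have h2 : diracKernel d n ζ η ≤
          q ^ n / (valleePoussinConst d n * (surf d).real Set.univ) := by
        rw [diracKernel_eq hd]
        have := one_add_dot_div_two_nonneg ζ η
        have hds := dist_sq_eq ζ η
        rw [dist_comm] at hds
        have : (1 + dot ζ η) / 2 ≤ q := by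
          rw [hq]
          nlinarith [pow_le_pow_left₀ hδ0.le hdist 2]
        gcongr
      have h3 : diracKernel d n ζ η * ‖f η - f ζ‖ ≤ b := by
        rw [hb, mul_comm (2 * ‖f‖)]
        exact mul_le_mul h2 h1 (norm_nonneg _) (by positivity)
      nlinarith [hR0 η]
  rw [dist_comm, dist_eq_norm, e1]
  calc _ ≤ ∫ η, (ε / 2 * diracKernel d n ζ η + b) ∂(surf d) :=
        norm_integral_le_of_norm_le
          (((integrable_of_continuous_sphere hcR).const_mul _).add (integrable_const b))
          (.of_forall hpt)
    _ = ε / 2 + 2 * ‖f‖ * (q ^ n / valleePoussinConst d n) := by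
        rw [integral_add ((integrable_of_continuous_sphere hcR).const_mul _) (integrable_const b),
          integral_const_mul, integral_diracKernel hd, integral_const, smul_eq_mul, hb]
        field_simp
    _ < ε := by linarith

end Kernel

/-! ### Long-time averages of trigonometric sums -/

theorem tendsto_average_cos {w : ℝ} (hw : w ≠ 0) :
    Tendsto (fun T : ℝ => 1 / T * ∫ t in (0 : ℝ)..T, Real.cos (w * t)) atTop (𝓝 0) := by
  have e (T : ℝ) : 1 / T * ∫ t in (0 : ℝ)..T, Real.cos (w * t)
      = T⁻¹ * (w⁻¹ * Real.sin (w * T)) := by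
    rw [intervalIntegral.integral_comp_mul_left _ hw]
    simp
  simp only [e]
  refine squeeze_zero_norm (a := fun T => |T⁻¹| * |w⁻¹|) (fun T => ?_) ?_
  · rw [norm_mul, norm_mul, Real.norm_eq_abs, Real.norm_eq_abs, Real.norm_eq_abs]
    gcongr
    exact mul_le_of_le_one_right (abs_nonneg _) (Real.abs_sin_le_one _)
  · simpa using (tendsto_inv_atTop_zero (𝕜 := ℝ)).abs.mul_const |w⁻¹|

theorem tendsto_average_sum_cos {lam : ℕ → ℝ} (hlam : Function.Injective lam) (s : Finset ℕ)
    (m : ℕ → ℕ → ℝ) :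
    Tendsto (fun T : ℝ => 1 / T * ∫ t in (0 : ℝ)..T,
      ∑ j ∈ s, ∑ k ∈ s, m j k * Real.cos ((lam j - lam k) * t)) atTop (𝓝 (∑ k ∈ s, m k k)) := by
  have hint (j k : ℕ) (T : ℝ) : IntervalIntegrable
      (fun t => m j k * Real.cos ((lam j - lam k) * t)) volume 0 T :=
    (by fun_prop : Continuous fun t => m j k * Real.cos ((lam j - lam k) * t)).intervalIntegrable
      _ _
  have e (T : ℝ) : 1 / T * ∫ t in (0 : ℝ)..T,
      ∑ j ∈ s, ∑ k ∈ s, m j k * Real.cos ((lam j - lam k) * t) =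
      ∑ j ∈ s, ∑ k ∈ s, m j k * (1 / T * ∫ t in (0 : ℝ)..T, Real.cos ((lam j - lam k) * t)) := by
    rw [intervalIntegral.integral_finsetSum fun j _ => Continuous.intervalIntegrable
      (continuous_finsetSum s fun k _ => by fun_prop) 0 T, Finset.mul_sum]
    refine Finset.sum_congr rfl fun j _ => ?_
    rw [intervalIntegral.integral_finsetSum fun k _ => hint j k T, Finset.mul_sum]
    refine Finset.sum_congr rfl fun k _ => ?_
    rw [intervalIntegral.integral_const_mul]
    ring
  simp only [e]
  have hd : ∑ k ∈ s, m k k = ∑ j ∈ s, ∑ k ∈ s, m j k * if j = k then 1 else 0 := by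
    refine Finset.sum_congr rfl fun j hj => ?_
    simp [hj]
  rw [hd]
  refine tendsto_finsetSum _ fun j _ => tendsto_finsetSum _ fun k _ => Tendsto.const_mul _ ?_
  split_ifs with h
  · subst h
    refine tendsto_const_nhds.congr' ?_
    filter_upwards [eventually_gt_atTop 0] with T hT
    simp [hT.ne']
  · exact tendsto_average_cos (sub_ne_zero.mpr (hlam.ne h))

theorem norm_sq_sum_exp (lam b : ℕ → ℝ) (s : Finset ℕ) (t : ℝ) :
    ‖∑ k ∈ s, (b k : ℂ) * Complex.exp (-(Complex.I * t * lam k))‖ ^ 2 =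
      ∑ j ∈ s, ∑ k ∈ s, b j * b k * Real.cos ((lam j - lam k) * t) := by
  have e (k : ℕ) : (b k : ℂ) * Complex.exp (-(Complex.I * t * lam k)) =
      ((b k * Real.cos (lam k * t) : ℝ) : ℂ) + ((-(b k * Real.sin (lam k * t)) : ℝ) : ℂ)
        * Complex.I := by
    rw [show -(Complex.I * t * lam k) = ((-(lam k * t) : ℝ) : ℂ) * Complex.I by push_cast; ring,
      Complex.exp_mul_I, ← Complex.ofReal_cos, ← Complex.ofReal_sin, Real.cos_neg, Real.sin_neg]
    push_cast
    ring
  simp only [e]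
  rw [Finset.sum_add_distrib, ← Finset.sum_mul, ← Complex.ofReal_sum, ← Complex.ofReal_sum,
    ← Complex.normSq_eq_norm_sq, Complex.normSq_add_mul_I, pow_two, pow_two, Finset.sum_mul_sum,
    Finset.sum_mul_sum, ← Finset.sum_add_distrib]
  refine Finset.sum_congr rfl fun j _ => ?_
  rw [← Finset.sum_add_distrib]
  refine Finset.sum_congr rfl fun k _ => ?_
  rw [sub_mul, Real.cos_sub]
  ring

/-! ### The Schrödinger evolution of zonal functions -/

section Evolution

variable {d : ℕ}

theorem zonal_eq_zonalFun (hd : 3 ≤ d) (k : ℕ) (ξ η : Sph d) :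
    (zonal d k ξ η : ℂ) = zonalFun (((surf d).real Set.univ)⁻¹ • zonalPoly d k) ξ η := by
  rw [zonal_eq hd, zonalFun, Polynomial.eval_smul, smul_eq_mul, inv_mul_eq_div]

/-- The zonal harmonic as a continuous complex-valued function. -/
def zonalMap (hd : 3 ≤ d) (k : ℕ) (ξ : Sph d) : C(Sph d, ℂ) :=
  ⟨fun η => (zonal d k ξ η : ℂ), Complex.continuous_ofReal.comp (continuous_zonal hd k ξ)⟩

theorem zonalMap_apply (hd : 3 ≤ d) (k : ℕ) (ξ η : Sph d) :
    zonalMap hd k ξ η = (zonal d k ξ η : ℂ) := rfl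

theorem smoothOnSphere_zonalMap (hd : 3 ≤ d) (k : ℕ) (ξ : Sph d) :
    SmoothOnSphere (zonalMap hd k ξ) := by
  have := smoothOnSphere_zonalFun (((surf d).real Set.univ)⁻¹ • zonalPoly d k) ξ
  rwa [← funext (zonal_eq_zonalFun hd k ξ)] at this

theorem sphereLaplacian_zonalMap (hd : 3 ≤ d) (k : ℕ) (ξ η : Sph d) :
    sphereLaplacian (zonalMap hd k ξ) η =
      -(sphereEigenvalue d k : ℂ) * zonalMap hd k ξ η := by
  have h : (zonalMap hd k ξ : Sph d → ℂ)
      = zonalFun (((surf d).real Set.univ)⁻¹ • zonalPoly d k) ξ :=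
    funext (zonal_eq_zonalFun hd k ξ)
  rw [h, sphereLaplacian_zonalFun, zonalFun, ← Complex.ofReal_neg, ← Complex.ofReal_mul]
  congr 1
  simp only [Polynomial.derivative_smul, Polynomial.eval_smul, smul_eq_mul, sphereEigenvalue]
  linear_combination ((surf d).real Set.univ)⁻¹ * zonalPoly_ode (d := d) k (dot ξ η)

/-- The zonal harmonic as an element of `L²`. -/
def zonalLp (hd : 3 ≤ d) (k : ℕ) (ξ : Sph d) : Lp ℂ 2 (surf d) :=
  ContinuousMap.toLp 2 (surf d) ℂ (zonalMap hd k ξ)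

theorem zonalLp_mem_eigenspace (hd : 3 ≤ d) (k : ℕ) (ξ : Sph d) :
    zonalLp hd k ξ ∈ eigenspace d (sphereEigenvalue d k) :=
  Submodule.le_topologicalClosure _ (Submodule.subset_span
    ⟨zonalMap hd k ξ, smoothOnSphere_zonalMap hd k ξ, sphereLaplacian_zonalMap hd k ξ,
      ContinuousMap.coeFn_toLp _ _⟩)

theorem zonalLp_mem_eigenspace_orthogonal (hd : 3 ≤ d) (k : ℕ) (ξ : Sph d) {lam : ℝ}
    (h : lam ≠ sphereEigenvalue d k) : zonalLp hd k ξ ∈ (eigenspace d lam)ᗮ := by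
  rw [eigenspace, Submodule.orthogonal_closure]
  refine (Submodule.mem_orthogonal' _ _).mpr fun F hF => ?_
  induction hF using Submodule.span_induction with
  | zero => exact inner_zero_right _
  | add x y _ _ hx hy => rw [inner_add_right, hx, hy, add_zero]
  | smul c x _ hx => rw [inner_smul_right, hx, mul_zero]
  | mem F hF =>
    obtain ⟨f, hf, hLf, hFf⟩ := hF
    rw [L2.inner_def, ← integral_mul_eq_zero_of_eigenfunctions (by omega : 0 < d) hf
      (smoothOnSphere_zonalMap hd k ξ) h hLf (sphereLaplacian_zonalMap hd k ξ)]
    refine integral_congr_ae ?_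
    filter_upwards [hFf, ContinuousMap.coeFn_toLp (p := 2) (𝕜 := ℂ) (surf d) (zonalMap hd k ξ)]
      with η h1 h2
    rw [h1, zonalLp, h2, RCLike.inner_apply, zonalMap_apply, Complex.conj_ofReal]

theorem schrodinger_sum_zonalLp (hd : 3 ≤ d) (t : ℝ) (ξ : Sph d) (s : Finset ℕ) (c : ℕ → ℂ) :
    schrodinger d t (∑ k ∈ s, c k • zonalLp hd k ξ) =
      ∑ k ∈ s, (c k * Complex.exp (-(Complex.I * t * sphereEigenvalue d k))) •
        zonalLp hd k ξ := by
  have hproj (lam : ℝ) (k : ℕ) : (eigenspace d lam).starProjection (zonalLp hd k ξ) =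
      if lam = sphereEigenvalue d k then zonalLp hd k ξ else 0 := by
    split_ifs with h
    · rw [h]
      exact Submodule.starProjection_eq_self_iff.mpr (zonalLp_mem_eigenspace hd k ξ)
    · exact (Submodule.starProjection_apply_eq_zero_iff _).mpr
        (zonalLp_mem_eigenspace_orthogonal hd k ξ h)
  have e (lam : ℝ) : Complex.exp (-(Complex.I * t * lam)) • (eigenspace d lam).starProjection
      (∑ k ∈ s, c k • zonalLp hd k ξ) =
      ∑ k ∈ s, if lam = sphereEigenvalue d k then
        (c k * Complex.exp (-(Complex.I * t * sphereEigenvalue d k))) • zonalLp hd k ξ else 0 := by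
    rw [map_sum, Finset.smul_sum]
    refine Finset.sum_congr rfl fun k _ => ?_
    rw [map_smul, hproj]
    split_ifs with h
    · rw [h, smul_smul, mul_comm]
    · simp
  rw [schrodinger]
  simp only [e]
  exact (hasSum_sum fun k _ => hasSum_ite_eq (sphereEigenvalue d k) _).tsum_eq

theorem normConst_pos (hd : 3 ≤ d) (n : ℕ) : 0 < normConst d n := by
  have hS := surf_real_univ_pos (by omega : 0 < d)
  exact Finset.sum_pos (fun k _ => mul_pos (pow_pos (weight_pos d n k) 2)
    (div_pos (harmDim_pos hd k) hS)) (by simp)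

/-- The coefficients of the normalized approximate Dirac mass in the zonal harmonics. -/
def diracCoeff (d n k : ℕ) : ℝ := weight d n k / √(normConst d n)

theorem diracCoeff_sq (hd : 3 ≤ d) (n k : ℕ) :
    diracCoeff d n k ^ 2 = weight d n k ^ 2 / normConst d n := by
  rw [diracCoeff, div_pow, Real.sq_sqrt (normConst_pos hd n).le]

theorem diracMass_eq (n : ℕ) (ξ η : Sph d) :
    diracMass d n ξ η = ∑ k ∈ Finset.range (n + 1), (diracCoeff d n k : ℂ) * zonal d k ξ η := by
  rw [diracMass, diracKernel, Finset.sum_div, Complex.ofReal_sum]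
  refine Finset.sum_congr rfl fun k _ => ?_
  rw [diracCoeff]
  push_cast
  ring

theorem memLp_diracMass (hd : 3 ≤ d) (n : ℕ) (ξ : Sph d) :
    MemLp (diracMass d n ξ) 2 (surf d) := by
  have : Continuous (diracMass d n ξ) :=
    Complex.continuous_ofReal.comp ((continuous_diracKernel hd n ξ).div_const _)
  exact this.memLp_of_hasCompactSupport (HasCompactSupport.of_compactSpace _)

theorem toLp_diracMass (hd : 3 ≤ d) (n : ℕ) (ξ : Sph d)
    (hS : MemLp (diracMass d n ξ) 2 (surf d)) :
    hS.toLp (diracMass d n ξ) =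
      ∑ k ∈ Finset.range (n + 1), (diracCoeff d n k : ℂ) • zonalLp hd k ξ := by
  simp only [zonalLp, ← map_smul, ← map_sum]
  refine Lp.ext ?_
  filter_upwards [hS.coeFn_toLp, ContinuousMap.coeFn_toLp (p := 2) (𝕜 := ℂ) (surf d)
    (∑ k ∈ Finset.range (n + 1), (diracCoeff d n k : ℂ) • zonalMap hd k ξ)] with η h1 h2
  rw [h1, h2, diracMass_eq]
  simp [zonalMap_apply]

/-- The continuous version of the Schrödinger evolution of the normalized approximate Dirac
mass. -/
def evolution (hd : 3 ≤ d) (ξ : Sph d) (n : ℕ) : C(ℝ × Sph d, ℂ) where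
  toFun p := ∑ k ∈ Finset.range (n + 1), ((diracCoeff d n k * zonal d k ξ p.2 : ℝ) : ℂ) *
    Complex.exp (-(Complex.I * p.1 * sphereEigenvalue d k))
  continuous_toFun := by
    refine continuous_finsetSum _ fun k _ => Continuous.mul ?_ (by fun_prop)
    exact Complex.continuous_ofReal.comp
      (((continuous_zonal hd k ξ).comp continuous_snd).const_mul _)

theorem schrodinger_diracMass_ae (hd : 3 ≤ d) (ξ : Sph d) (n : ℕ) (t : ℝ)
    (hS : MemLp (diracMass d n ξ) 2 (surf d)) :
    schrodinger d t (hS.toLp (diracMass d n ξ)) =ᵐ[surf d] fun η => evolution hd ξ n (t, η) := by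
  rw [toLp_diracMass hd n ξ hS, schrodinger_sum_zonalLp]
  simp only [zonalLp, ← map_smul, ← map_sum]
  refine (ContinuousMap.coeFn_toLp _ _).trans (.of_forall fun η => ?_)
  simp only [evolution, ContinuousMap.coe_mk, ContinuousMap.sum_apply, ContinuousMap.smul_apply,
    zonalMap_apply, smul_eq_mul]
  refine Finset.sum_congr rfl fun k _ => ?_
  push_cast
  ring

theorem norm_sq_evolution (hd : 3 ≤ d) (ξ : Sph d) (n : ℕ) (t : ℝ) (η : Sph d) :
    ‖evolution hd ξ n (t, η)‖ ^ 2 =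
      ∑ j ∈ Finset.range (n + 1), ∑ k ∈ Finset.range (n + 1),
        (diracCoeff d n j * zonal d j ξ η) * (diracCoeff d n k * zonal d k ξ η) *
          Real.cos ((sphereEigenvalue d j - sphereEigenvalue d k) * t) :=
  norm_sq_sum_exp (sphereEigenvalue d) (fun k => diracCoeff d n k * zonal d k ξ η) _ t

/-- The long-time average of the density of the evolution of the approximate Dirac mass. -/
def averageDensity (hd : 3 ≤ d) (ξ : Sph d) (n : ℕ) : C(Sph d, ℝ) where
  toFun η := ∑ k ∈ Finset.range (n + 1), diracCoeff d n k ^ 2 * zonal d k ξ η ^ 2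
  continuous_toFun :=
    continuous_finsetSum _ fun k _ => ((continuous_zonal hd k ξ).pow 2).const_mul _

theorem averageDensity_apply (hd : 3 ≤ d) (ξ : Sph d) (n : ℕ) (η : Sph d) :
    averageDensity hd ξ n η =
      ∑ k ∈ Finset.range (n + 1), diracCoeff d n k ^ 2 * zonal d k ξ η ^ 2 := rfl

theorem tendsto_average_norm_sq_evolution (hd : 3 ≤ d) (ξ : Sph d) (n : ℕ) (η : Sph d) :
    Tendsto (fun T : ℝ => 1 / T * ∫ t in (0 : ℝ)..T, ‖evolution hd ξ n (t, η)‖ ^ 2)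
      atTop (𝓝 (averageDensity hd ξ n η)) := by
  simp only [norm_sq_evolution]
  have h := tendsto_average_sum_cos (sphereEigenvalue_injective hd) (Finset.range (n + 1))
    fun j k => (diracCoeff d n j * zonal d j ξ η) * (diracCoeff d n k * zonal d k ξ η)
  have e : averageDensity hd ξ n η = ∑ k ∈ Finset.range (n + 1),
      (diracCoeff d n k * zonal d k ξ η) * (diracCoeff d n k * zonal d k ξ η) := by
    rw [averageDensity_apply]
    exact Finset.sum_congr rfl fun k _ => by ring
  rwa [e]

theorem integral_mul_averageDensity (hd : 3 ≤ d) (ξ : Sph d) (n : ℕ) {a : Sph d → ℝ}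
    (ha : Continuous a) :
    ∫ η, a η * averageDensity hd ξ n η ∂(surf d) =
      ∑ k ∈ Finset.range (n + 1), diracCoeff d n k ^ 2 *
        ∫ η, a η * zonal d k ξ η ^ 2 ∂(surf d) := by
  simp only [averageDensity_apply, Finset.mul_sum]
  rw [integral_finsetSum]
  · refine Finset.sum_congr rfl fun k _ => ?_
    rw [← integral_const_mul]
    congr 1
    ext η
    ring
  · intro k _
    exact integrable_of_continuous_sphere
      (ha.mul (((continuous_zonal hd k ξ).pow 2).const_mul _))

theorem tendsto_average_expectation (hd : 3 ≤ d) (ξ : Sph d) (n : ℕ) {a : Sph d → ℝ}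
    (ha : Continuous a) (hS : MemLp (diracMass d n ξ) 2 (surf d)) :
    Tendsto (fun T : ℝ => 1 / T * ∫ t in (0 : ℝ)..T,
        expectation a (schrodinger d t (hS.toLp (diracMass d n ξ))))
      atTop (𝓝 (∫ η, a η * averageDensity hd ξ n η ∂(surf d))) := by
  have hc (j k : ℕ) (x : ℝ) : Integrable (fun η =>
      a η * ((diracCoeff d n j * zonal d j ξ η) * (diracCoeff d n k * zonal d k ξ η) * x))
      (surf d) :=
    integrable_of_continuous_sphere (ha.mul ((((continuous_zonal hd j ξ).const_mul _).mul
      ((continuous_zonal hd k ξ).const_mul _)).mul_const _))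
  have e (t : ℝ) : expectation a (schrodinger d t (hS.toLp (diracMass d n ξ))) =
      ∑ j ∈ Finset.range (n + 1), ∑ k ∈ Finset.range (n + 1),
        (diracCoeff d n j * diracCoeff d n k *
          ∫ η, a η * (zonal d j ξ η * zonal d k ξ η) ∂(surf d)) *
          Real.cos ((sphereEigenvalue d j - sphereEigenvalue d k) * t) := by
    have h1 : expectation a (schrodinger d t (hS.toLp (diracMass d n ξ))) =
        ∫ η, a η * ‖evolution hd ξ n (t, η)‖ ^ 2 ∂(surf d) := by
      refine integral_congr_ae ?_
      filter_upwards [schrodinger_diracMass_ae hd ξ n t hS] with η hη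
      rw [hη]
    rw [h1]
    simp only [norm_sq_evolution, Finset.mul_sum]
    rw [integral_finsetSum _ fun j _ => integrable_finsetSum _ fun k _ => hc j k _]
    refine Finset.sum_congr rfl fun j _ => ?_
    rw [integral_finsetSum _ fun k _ => hc j k _]
    refine Finset.sum_congr rfl fun k _ => ?_
    rw [mul_right_comm, ← integral_const_mul]
    congr 1
    ext η
    ring
  simp only [e]
  rw [integral_mul_averageDensity hd ξ n ha]
  have h := tendsto_average_sum_cos (sphereEigenvalue_injective hd) (Finset.range (n + 1))
    fun j k => diracCoeff d n j * diracCoeff d n k *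
      ∫ η, a η * (zonal d j ξ η * zonal d k ξ η) ∂(surf d)
  simpa only [← pow_two] using h

end Evolution

/-! ### Weighted averages over the spectrum -/

section Averages

variable {d : ℕ}

/-- The probability that the normalized approximate Dirac mass has degree `k`. -/
def spectralWeight (d n k : ℕ) : ℝ :=
  diracCoeff d n k ^ 2 * (harmDim d k / (surf d).real Set.univ)

theorem spectralWeight_nonneg (hd : 3 ≤ d) (n k : ℕ) : 0 ≤ spectralWeight d n k := by
  have := harmDim_pos hd k
  unfold spectralWeight
  positivity

theorem sum_spectralWeight (hd : 3 ≤ d) (n : ℕ) :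
    ∑ k ∈ Finset.range (n + 1), spectralWeight d n k = 1 := by
  have h : ∑ k ∈ Finset.range (n + 1), spectralWeight d n k = normConst d n / normConst d n := by
    rw [normConst.eq_def d n, Finset.sum_div, ← normConst.eq_def d n]
    refine Finset.sum_congr rfl fun k _ => ?_
    rw [spectralWeight, diracCoeff_sq hd]
    ring
  rw [h, div_self (normConst_pos hd n).ne']

theorem tendsto_normConst (hd : 3 ≤ d) : Tendsto (normConst d) atTop atTop := by
  have hS := surf_real_univ_pos (by omega : 0 < d)
  rw [tendsto_atTop]
  intro b
  obtain ⟨K, hK⟩ := exists_nat_gt (b * (surf d).real Set.univ)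
  have hlim : Tendsto (fun n => ∑ k ∈ Finset.range K,
      weight d n k ^ 2 * (harmDim d k / (surf d).real Set.univ)) atTop
      (𝓝 (∑ k ∈ Finset.range K, 1 ^ 2 * (harmDim d k / (surf d).real Set.univ))) :=
    tendsto_finsetSum _ fun k _ => ((tendsto_weight hd k).pow 2).mul_const _
  have hlt : b < ∑ k ∈ Finset.range K, 1 ^ 2 * (harmDim d k / (surf d).real Set.univ) := by
    calc b < K / (surf d).real Set.univ := by rwa [lt_div_iff₀ hS]
      _ = ∑ k ∈ Finset.range K, 1 / (surf d).real Set.univ := by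
        rw [Finset.sum_const, Finset.card_range, nsmul_eq_mul, mul_one_div]
      _ ≤ _ := by
        refine Finset.sum_le_sum fun k _ => ?_
        rw [one_pow, one_mul]
        gcongr
        exact one_le_harmDim hd k
  filter_upwards [hlim.eventually_const_lt hlt, eventually_ge_atTop K] with n hn hKn
  refine hn.le.trans (Finset.sum_le_sum_of_subset_of_nonneg
    (Finset.range_subset_range.mpr (by omega)) fun k _ _ => ?_)
  have := harmDim_pos hd k
  positivity

theorem tendsto_spectralWeight (hd : 3 ≤ d) (k : ℕ) :
    Tendsto (fun n => spectralWeight d n k) atTop (𝓝 0) := by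
  have h := (((tendsto_weight hd k).pow 2).div_atTop (tendsto_normConst hd)).mul_const
    (harmDim d k / (surf d).real Set.univ)
  rw [zero_mul] at h
  exact h.congr fun n => by rw [spectralWeight, diracCoeff_sq hd]

/-- Toeplitz's lemma for divergent sequences. -/
theorem tendsto_weighted_average_atTop {w : ℕ → ℕ → ℝ} {g : ℕ → ℝ} (hw0 : ∀ n k, 0 ≤ w n k)
    (hw1 : ∀ n, ∑ k ∈ Finset.range (n + 1), w n k = 1)
    (hw : ∀ k, Tendsto (fun n => w n k) atTop (𝓝 0)) (hg0 : ∀ k, 0 ≤ g k)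
    (hg : Tendsto g atTop atTop) :
    Tendsto (fun n => ∑ k ∈ Finset.range (n + 1), w n k * g k) atTop atTop := by
  rw [tendsto_atTop]
  intro b
  set B := max b 0 with hB
  have hB0 : 0 ≤ B := le_max_right _ _
  obtain ⟨K, hK⟩ := eventually_atTop.mp (hg.eventually_ge_atTop (2 * B))
  have hlim : Tendsto (fun n => ∑ k ∈ Finset.range K, w n k) atTop (𝓝 0) := by
    simpa using tendsto_finsetSum (Finset.range K) fun k _ => hw k
  filter_upwards [hlim.eventually_lt_const one_half_pos, eventually_ge_atTop K] with n hn hKn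
  have hsub : Finset.range K ⊆ Finset.range (n + 1) :=
    Finset.range_subset_range.mpr (by omega)
  have h1 := Finset.sum_sdiff (f := fun k => w n k) hsub
  rw [hw1] at h1
  calc b ≤ B := le_max_left _ _
    _ ≤ (∑ k ∈ Finset.range (n + 1) \ Finset.range K, w n k) * (2 * B) := by nlinarith
    _ = ∑ k ∈ Finset.range (n + 1) \ Finset.range K, w n k * (2 * B) := Finset.sum_mul _ _ _
    _ ≤ ∑ k ∈ Finset.range (n + 1) \ Finset.range K, w n k * g k := by
      refine Finset.sum_le_sum fun k hk => mul_le_mul_of_nonneg_left (hK k ?_) (hw0 n k)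
      simpa using (Finset.mem_sdiff.mp hk).2
    _ ≤ _ := Finset.sum_le_sum_of_subset_of_nonneg Finset.sdiff_subset
      fun k _ _ => mul_nonneg (hw0 n k) (hg0 k)

theorem tendsto_averageDensity_pole (hd : 3 ≤ d) (ξ η : Sph d) (h : dot ξ η ^ 2 = 1) :
    Tendsto (fun n => averageDensity hd ξ n η) atTop atTop := by
  have hS := surf_real_univ_pos (by omega : 0 < d)
  refine (tendsto_weighted_average_atTop (spectralWeight_nonneg hd) (sum_spectralWeight hd)
    (tendsto_spectralWeight hd) (fun k => (div_pos (harmDim_pos hd k) hS).le)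
    ((tendsto_harmDim hd).atTop_div_const hS)).congr fun n => ?_
  rw [averageDensity_apply]
  refine Finset.sum_congr rfl fun k _ => ?_
  rw [zonal_eq hd, zonalPoly_eval_of_sq_eq_one hd h, spectralWeight, div_pow, mul_pow, ← pow_mul,
    mul_comm k 2, pow_mul, h, one_pow]
  ring

theorem exists_averageDensity_le (hd : 3 ≤ d) {ξ η : Sph d} (h : |dot ξ η| < 1) :
    ∃ C : ℝ, ∀ n, averageDensity hd ξ n η ≤ C := by
  have hS := surf_real_univ_pos (by omega : 0 < d)
  obtain ⟨C, hC⟩ := exists_zonalPoly_sq_le hd h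
  refine ⟨C / (surf d).real Set.univ, fun n => ?_⟩
  have h1 := congrArg (C / (surf d).real Set.univ * ·) (sum_spectralWeight hd n)
  simp only [mul_one, Finset.mul_sum] at h1
  rw [averageDensity_apply, ← h1]
  refine Finset.sum_le_sum fun k _ => ?_
  rw [zonal_eq hd, div_pow, spectralWeight]
  calc _ ≤ diracCoeff d n k ^ 2 * (C * harmDim d k / (surf d).real Set.univ ^ 2) := by
        gcongr
        exact hC k
    _ = _ := by ring

theorem integral_averageDensity (hd : 3 ≤ d) (ξ : Sph d) (n : ℕ) :
    ∫ η, averageDensity hd ξ n η ∂(surf d) = 1 := by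
  have h := integral_mul_averageDensity hd ξ n (a := fun _ => 1) continuous_const
  simp only [one_mul] at h
  rw [h]
  refine (Finset.sum_congr rfl fun k _ => ?_).trans (sum_spectralWeight hd n)
  simp only [pow_two (zonal d k ξ _), integral_zonal_mul_zonal hd, if_true, spectralWeight]

theorem norm_toLp_diracMass (hd : 3 ≤ d) (n : ℕ) (ξ : Sph d)
    (hS : MemLp (diracMass d n ξ) 2 (surf d)) : ‖hS.toLp (diracMass d n ξ)‖ = 1 := by
  have hi (j k : ℕ) : inner ℂ (zonalLp hd j ξ) (zonalLp hd k ξ) =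
      ((if j = k then harmDim d k / (surf d).real Set.univ else 0 : ℝ) : ℂ) := by
    rw [← integral_zonal_mul_zonal hd ξ j k, ← integral_complex_ofReal, L2.inner_def]
    refine integral_congr_ae ?_
    filter_upwards [ContinuousMap.coeFn_toLp (p := 2) (𝕜 := ℂ) (surf d) (zonalMap hd j ξ),
      ContinuousMap.coeFn_toLp (p := 2) (𝕜 := ℂ) (surf d) (zonalMap hd k ξ)] with η h1 h2
    rw [zonalLp, zonalLp, h1, h2, RCLike.inner_apply, zonalMap_apply, zonalMap_apply,
      Complex.conj_ofReal]
    push_cast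
    ring
  have h : inner ℂ (hS.toLp (diracMass d n ξ)) (hS.toLp (diracMass d n ξ)) =
      ((∑ k ∈ Finset.range (n + 1), spectralWeight d n k : ℝ) : ℂ) := by
    rw [toLp_diracMass hd n ξ hS, sum_inner, Complex.ofReal_sum]
    refine Finset.sum_congr rfl fun j hj => ?_
    rw [inner_sum, Finset.sum_eq_single j]
    · rw [inner_smul_left, inner_smul_right, hi, if_pos rfl, Complex.conj_ofReal, spectralWeight]
      push_cast
      ring
    · intro k _ hk
      rw [inner_smul_left, inner_smul_right, hi, if_neg hk.symm]
      simp
    · exact fun h => absurd hj h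
  rw [sum_spectralWeight hd n, Complex.ofReal_one] at h
  rw [@norm_eq_sqrt_re_inner ℂ, h]
  simp

theorem continuous_dot_sq (ξ : Sph d) : Continuous fun η : Sph d => dot ξ η ^ 2 :=
  (continuous_dot_right ξ).pow 2

theorem integral_dot_sq_mul_averageDensity_ge (hd : 3 ≤ d) (ξ : Sph d) (n : ℕ) :
    3 / (2 * d) * (1 - spectralWeight d n 0) ≤
      ∫ η, dot ξ η ^ 2 * averageDensity hd ξ n η ∂(surf d) := by
  rw [integral_mul_averageDensity hd ξ n (continuous_dot_sq ξ)]
  have e : ∑ k ∈ Finset.range (n + 1), diracCoeff d n k ^ 2 *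
        ∫ η, dot ξ η ^ 2 * zonal d k ξ η ^ 2 ∂(surf d) =
      ∑ k ∈ Finset.range (n + 1), spectralWeight d n k * zonalMoment d k := by
    refine Finset.sum_congr rfl fun k _ => ?_
    rw [integral_dot_sq_mul_zonal_sq hd, spectralWeight]
    ring
  have h1 := sum_spectralWeight hd n
  rw [Finset.sum_range_succ'] at h1
  have h0 : 0 ≤ spectralWeight d n 0 * zonalMoment d 0 :=
    mul_nonneg (spectralWeight_nonneg hd n 0) (by rw [zonalMoment_zero hd]; positivity)
  rw [e, Finset.sum_range_succ', ← h1, add_sub_cancel_right, Finset.mul_sum]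
  refine le_trans (Finset.sum_le_sum fun k _ => ?_) (le_add_of_nonneg_right h0)
  rw [mul_comm]
  exact mul_le_mul_of_nonneg_left (zonalMoment_succ_ge hd k) (spectralWeight_nonneg hd n _)

theorem tendsto_moment_lower_bound (hd : 3 ≤ d) :
    Tendsto (fun n => 3 / (2 * d) * (1 - spectralWeight d n 0)) atTop (𝓝 (3 / (2 * (d : ℝ)))) := by
  simpa using ((tendsto_spectralWeight hd 0).const_sub 1).const_mul (3 / (2 * (d : ℝ)))

theorem not_tendsto_moment (hd : 3 ≤ d) (ξ : Sph d) :
    ¬ Tendsto (fun n => ∫ η, dot ξ η ^ 2 * averageDensity hd ξ n η ∂(surf d)) atTop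
      (𝓝 (⨍ η, dot ξ η ^ 2 ∂(surf d))) := by
  intro h
  rw [average_dot_sq hd] at h
  have hd0 : (0 : ℝ) < d := by exact_mod_cast (by omega : 0 < d)
  have h1 := le_of_tendsto_of_tendsto' (tendsto_moment_lower_bound hd) h
    (integral_dot_sq_mul_averageDensity_ge hd ξ)
  rw [div_le_div_iff₀ (by positivity) hd0] at h1
  linarith

end Averages

end SphereFlow

end

theorem mainTheorem6 (d : ℕ) (hd : 3 ≤ d) (ξ : Sph d) :
    -- the kernels `R_ζ^{(n)}`, of which the `S_ζ^{(n)}` are the normalizations, approximate `δ_ζ`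
    (∀ f : C(Sph d, ℂ), TendstoUniformly
      (fun (n : ℕ) (ζ : Sph d) => ∫ η, (diracKernel d n ζ η : ℂ) * f η ∂(surf d)) f atTop) ∧
    -- `S_ξ^{(n)}` is normalized in `L²`
    ∃ hS : ∀ n : ℕ, MemLp (diracMass d n ξ) 2 (surf d),
    (∀ n, ‖(hS n).toLp (diracMass d n ξ)‖ = 1) ∧
    -- `v n (t, ·)` is the continuous version of `exp (i t Δ) S_ξ^{(n)}`
    (∃ (v : ℕ → C(ℝ × Sph d, ℂ)) (p : ℕ → C(Sph d, ℝ)),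
      (∀ n t, ∀ᵐ η ∂(surf d),
        schrodinger d t ((hS n).toLp (diracMass d n ξ)) η = v n (t, η)) ∧
      -- `p n` is the long-time average of its density, and a probability density
      (∀ n η, Tendsto (fun T : ℝ => 1 / T * ∫ t in (0 : ℝ)..T, ‖v n (t, η)‖ ^ 2)
        atTop (𝓝 (p n η))) ∧
      (∀ n, ∫ η, p n η ∂(surf d) = 1) ∧
      -- no equidistribution
      (¬ ∀ a : C(Sph d, ℝ), Tendsto (fun n => ∫ η, a η * p n η ∂(surf d))
        atTop (𝓝 (⨍ η, a η ∂(surf d)))) ∧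
      -- divergence at `± ξ`, boundedness elsewhere
      Tendsto (fun n => p n ξ) atTop atTop ∧
      Tendsto (fun n => p n (-ξ)) atTop atTop ∧
      (∀ η, η ≠ ξ → η ≠ -ξ → ∃ C : ℝ, ∀ n, p n η ≤ C)) ∧
    -- the observable `a(η) = (ξ · η)²` for `d = 3`
    (d = 3 →
      ∃ A : ℕ → ℝ,
        (∀ n, Tendsto (fun T : ℝ => 1 / T * ∫ t in (0 : ℝ)..T,
            expectation (fun η => dot ξ η ^ 2)
              (schrodinger d t ((hS n).toLp (diracMass d n ξ))))
          atTop (𝓝 (A n))) ∧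
        ((1 / 2 : ℝ) : EReal) ≤ liminf (fun n => (A n : EReal)) atTop ∧
        ⨍ η, dot ξ η ^ 2 ∂(surf d) = 1 / 3 ∧
        ¬ Tendsto A atTop (𝓝 (⨍ η, dot ξ η ^ 2 ∂(surf d)))) := by
  refine ⟨tendstoUniformly_integral_diracKernel hd, fun n => memLp_diracMass hd n ξ,
    fun n => norm_toLp_diracMass hd n ξ _,
    ⟨evolution hd ξ, averageDensity hd ξ, fun n t => schrodinger_diracMass_ae hd ξ n t _,
      tendsto_average_norm_sq_evolution hd ξ, integral_averageDensity hd ξ, fun h => ?_,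
      tendsto_averageDensity_pole hd ξ ξ (by rw [dot_self, one_pow]),
      tendsto_averageDensity_pole hd ξ (-ξ) (by rw [dot_neg_self]; norm_num),
      fun η h1 h2 => exists_averageDensity_le hd (abs_dot_lt_one_of_ne h1 h2)⟩, ?_⟩
  · exact not_tendsto_moment hd ξ (h ⟨fun η => dot ξ η ^ 2, continuous_dot_sq ξ⟩)
  · rintro rfl
    refine ⟨fun n => ∫ η, dot ξ η ^ 2 * averageDensity hd ξ n η ∂(surf 3),
      fun n => tendsto_average_expectation hd ξ n (continuous_dot_sq ξ) _, ?_, ?_,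
      not_tendsto_moment hd ξ⟩
    · have h := (continuous_coe_real_ereal.tendsto _).comp (tendsto_moment_lower_bound hd)
      rw [show (1 / 2 : ℝ) = 3 / (2 * ((3 : ℕ) : ℝ)) by norm_num, ← h.liminf_eq]
      exact liminf_le_liminf (.of_forall fun n =>
        EReal.coe_le_coe_iff.mpr (integral_dot_sq_mul_averageDensity_ge hd ξ n))
    · simpa using average_dot_sq hd ξ
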